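/- Let $k$ be a perfect field of characteristic two, let $G=C_2\times C_2=\langle g_1,g_2\rangle$ be the Klein four-group, let $f\in k[T]$ be a monic irreducible polynomial of degree $m$, and let $n\ge 1$. Let $\Pi\in\mathrm{Mat}_{mn}(k)$ be the companion matrix of $f^n$ (ones on the first subdiagonal, the coefficients $a_0,\dots,a_{mn-1}$ of $f^n$ in the last column). Let $C_n(f)$ be the $kG$-module $k^{2mn}$ (column vectors) on which $$g_1=\begin{pmatrix} I_{mn}&I_{mn}\\0&I_{mn}\end{pmatrix},\qquad g_2=\begin{pmatrix} I_{mn}&\Pi\\0&I_{mn}\end{pmatrix}.$$ Forms. A bilinear form is symplectic if it is alternating and non-degenerate. A $G$-invariant symplectic form $S$ on a $kG$-module $M$ is indecomposable if $(M,S)$ is not an orthogonal sum of two smaller symplectic $kG$-modules. Two bilinear forms $B,B'$ (or two quadratic forms $q,q'$) on $M$ are isometric if $B(\alpha x,\alpha y)=B'(x,y)$ for all $x,y\in M$ (respectively $q(\alpha x)=q'(x)$ for all $x\in M$) for some $kG$-automorphism $\alpha$ of $M$. The bilinear form associated with a quadratic form $q$ is $(x,y)\mapsto q(x+y)-q(x)-q(y)$;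 a square matrix $Q$ defines the quadratic form $x\mapsto x^TQx$. Matrices. Let $K=k[\epsilon]$ with $\epsilon$ a root of $f$. Let $E\supseteq k$ be a field that contains $m$ distinct roots $\epsilon_1,\dots,\epsilon_m$ of $f$, and let $\sigma_t:K\to E$ be the $k$-homomorphism with $\sigma_t(\epsilon)=\epsilon_t$. Let $J=\mathrm{diag}(J_n(\epsilon_1),\dots,J_n(\epsilon_m))$, where $J_n(\alpha)$ is the $n\times n$ Jordan block with $\alpha$ on the diagonal and ones on the superdiagonal. Let $V\in\mathrm{Mat}_{mn}(E)$ be the matrix whose first column is $(e_n,\dots,e_n)^T$ ($m$ copies of the $n$-th unit vector of length $n$) and whose $(i+1)$-st column is $J$ times its $i$-th column. For $X\in\mathrm{Mat}_n(K)$ put $$\mathcal V(X)=V^T\,\mathrm{diag}(\sigma_1(X),\dots,\sigma_m(X))\,V .$$ Let $H_i(x)$ be the $n\times n$ matrix whose entries in positions $(s,t)$ with $s+t=i$ equal $x$, all other entries being $0$, and let $$\mathcal H=\Big\{H_{n+1}(1)+\sum_{2\le i\le n,\ i\text{ even}}H_{n+i}(a_i)\ :\ a_i\in K\Big\}.$$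 Finally let $\mathcal P\subseteq k$ be any full set of representatives for the cosets of the additive subgroup $\{x^2+x:x\in k\}$ in $(k,+)$. Then $\mathcal V(X)$ has all its entries in $k$ for every $X\in\mathrm{Mat}_n(K)$. For $A\in\mathcal H$ let $S(A)$ be the bilinear form on $C_n(f)$ with Gram matrix $\begin{pmatrix}0&\mathcal V(A)\\ \mathcal V(A)&0\end{pmatrix}$. (a) Every $G$-invariant symplectic form on $C_n(f)$ is indecomposable. The forms $S(A)$, $A\in\mathcal H$, are pairwise distinct and are a full set of representatives for the isometry classes of indecomposable $G$-invariant symplectic forms on $C_n(f)$. In particular, if $k$ is finite, then there are exactly $|k|^{m\lfloor n/2\rfloor}$ isometry classes. (b) Let $A\in\mathcal H$. There is a $G$-invariant quadratic form on $C_n(f)$ with associated bilinear form $S(A)$ if and only if one of the following holds: 1. $n$ is odd, $f\in\{T,T+1\}$, and $A=1$ if $n=1$, while $A=H_{n+1}(1)+H_{n+2}(1)$ if $n\ge 3$; 2. $n$ is even, $f\notin\{T,T+1\}$, and $A=H_{n+1}(1)+\sum_{2\le i\le n,\ i\text{ even}}H_{n+i}\big((\epsilon+\epsilon^2)^{-i/2}\big)$.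 In these cases the $G$-invariant quadratic forms with associated bilinear form $S(A)$ are precisely those given by the matrices $$Q_A(D)=\begin{pmatrix} D_A&\mathcal V(A)\\0&D\end{pmatrix},\qquad D\in\mathrm{Mat}_{mn}(k)\text{ diagonal},$$ where $D_A$ is the diagonal matrix with the same diagonal as $\mathcal V(A)$. Moreover some diagonal entry of $\mathcal V(A)^{-1}$ is non-zero, and for every $t$ with $v:=(\mathcal V(A)^{-1})_{t,t}\ne 0$ the forms given by $Q_A(E_{t,t}(v^{-1}x))$, $x\in\mathcal P$, are pairwise distinct and are a full set of representatives for the isometry classes of these quadratic forms; here $E_{t,t}(y)$ is the matrix with $(t,t)$-entry $y$ and all other entries $0$. In particular there are $|\mathcal P|$ isometry classes. -/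

import Mathlib

open Polynomial

noncomputable section

/-! ### Symplectic modules and quadratic forms over a group algebra -/

section Forms

variable {k G M : Type*} [Field k] [Group G] [AddCommGroup M] [Module k M]

/-- A bilinear form is symplectic if it is alternating and non-degenerate. -/
def IsSymplectic (B : LinearMap.BilinForm k M) : Prop :=
  B.IsAlt ∧ B.Nondegenerate

/-- `G`-invariance of a bilinear form. -/
def IsInvariantForm (ρ : Representation k G M) (B : LinearMap.BilinForm k M) : Prop :=
  ∀ (g : G) (x y : M), B (ρ g x) (ρ g y) = B x y

/-- `(M, B)` is an orthogonal sum of two smaller symplectic `kG`-modules. -/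
def IsOrthogonallyDecomposable (ρ : Representation k G M) (B : LinearMap.BilinForm k M) : Prop :=
  ∃ N₁ N₂ : Submodule k M,
    (∀ (g : G), ∀ x ∈ N₁, ρ g x ∈ N₁) ∧ (∀ (g : G), ∀ x ∈ N₂, ρ g x ∈ N₂) ∧
    IsCompl N₁ N₂ ∧ N₁ ≠ ⊤ ∧ N₂ ≠ ⊤ ∧
    (∀ x ∈ N₁, ∀ y ∈ N₂, B x y = 0) ∧
    IsSymplectic (B.restrict N₁) ∧ IsSymplectic (B.restrict N₂)

/-- The forms `B` for which `(M, B)` is an indecomposable symplectic `kG`-module. -/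
def IndecomposableSymplecticForms (ρ : Representation k G M) : Set (LinearMap.BilinForm k M) :=
  {B | IsSymplectic B ∧ IsInvariantForm ρ B ∧ ¬ IsOrthogonallyDecomposable ρ B}

/-- Two forms on `M` are isometric if some `kG`-automorphism of `M` carries one to the other. -/
def IsometricForms (ρ : Representation k G M) (B B' : LinearMap.BilinForm k M) : Prop :=
  ∃ α : M ≃ₗ[k] M, (∀ (g : G) (x : M), α (ρ g x) = ρ g (α x)) ∧
    ∀ x y : M, B (α x) (α y) = B' x y

/-- The `G`-invariant quadratic forms on `M` with associated bilinear form
`B x y = q (x + y) - q x - q y`. -/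
def InvariantQuadraticForms (ρ : Representation k G M) (B : LinearMap.BilinForm k M) :
    Set (QuadraticForm k M) :=
  {q | (∀ (g : G) (x : M), q (ρ g x) = q x) ∧ QuadraticMap.polarBilin q = B}

/-- Two quadratic forms on `M` are isometric if some `kG`-automorphism of `M` carries one
to the other. -/
def IsometricQuadraticForms (ρ : Representation k G M) (q q' : QuadraticForm k M) : Prop :=
  ∃ α : M ≃ₗ[k] M, (∀ (g : G) (x : M), α (ρ g x) = ρ g (α x)) ∧ ∀ x : M, q (α x) = q' x

end Forms

/-- `R` is a full set of representatives for the classes of the relation `r` on `C`: it consists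
of elements of `C`, and every element of `C` is related to exactly one element of `R`. -/
def IsFullSetOfReps {α : Type*} (r : α → α → Prop) (C R : Set α) : Prop :=
  R ⊆ C ∧ ∀ x ∈ C, ∃! y, y ∈ R ∧ r y x

/-- `P` is a full set of representatives for the cosets of `{x ^ 2 + x : x ∈ k}` in `(k, +)`. -/
def IsCosetReps {k : Type*} [Field k] (P : Set k) : Prop :=
  IsFullSetOfReps (fun a b : k => ∃ x : k, a - b = x ^ 2 + x) Set.univ P

/-! ### The module `C_n(f)` for the Klein four-group -/

/-- The Klein four-group `C₂ × C₂`. -/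
abbrev KleinFourGroup : Type := Multiplicative (ZMod 2) × Multiplicative (ZMod 2)

section Module

variable {k : Type*} [Field k]

/-- The index set `{1, …, mn}`, where `m` is the degree of `f`. -/
abbrev Idx (f : k[X]) (n : ℕ) : Type := Fin (f.natDegree * n)

/-- The companion matrix of `f ^ n`: ones on the first subdiagonal, and the coefficients of
`f ^ n` in the last column (the sign is immaterial in characteristic two). -/
def companionPow (f : k[X]) (n : ℕ) : Matrix (Idx f n) (Idx f n) k :=
  Matrix.of fun i j =>
    if j.val + 1 = f.natDegree * n then (f ^ n).coeff i.val
    else if i.val = j.val + 1 then 1 else 0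

/-- The underlying vector space `k ^ (2mn)` of `C_n(f)`, in two blocks of length `mn`. -/
abbrev CSpace (f : k[X]) (n : ℕ) : Type _ := Idx f n ⊕ Idx f n → k

/-- The block matrix `(I P; 0 I)`. -/
def unipotentBlock {ι : Type*} [DecidableEq ι] (P : Matrix ι ι k) : Matrix (ι ⊕ ι) (ι ⊕ ι) k :=
  Matrix.fromBlocks 1 P 0 1

lemma unipotentBlock_mul {ι : Type*} [DecidableEq ι] [Fintype ι] (P Q : Matrix ι ι k) :
    unipotentBlock P * unipotentBlock Q = unipotentBlock (P + Q) := by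
  simp [unipotentBlock, Matrix.fromBlocks_multiply, add_comm]

lemma unipotentBlock_pow_two [CharP k 2] {ι : Type*} [DecidableEq ι] [Fintype ι]
    (P : Matrix ι ι k) : unipotentBlock P ^ 2 = 1 := by
  have h : P + P = 0 := by ext i j; exact CharTwo.add_self_eq_zero _
  rw [pow_two, unipotentBlock_mul, h, unipotentBlock, Matrix.fromBlocks_one]

lemma unipotentBlock_pow_val_add [CharP k 2] {ι : Type*} [DecidableEq ι] [Fintype ι]
    (P : Matrix ι ι k) (a b : ZMod 2) :
    unipotentBlock P ^ (a + b).val = unipotentBlock P ^ a.val * unipotentBlock P ^ b.val := by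
  rw [← pow_add, ZMod.val_add]
  exact (pow_eq_pow_mod _ (unipotentBlock_pow_two P)).symm

/-- The `kG`-module `C_n(f)`: the generators `g₁` and `g₂` of `G = C₂ × C₂` act on column vectors
by the matrices `(I I; 0 I)` and `(I Π; 0 I)`, with `Π` the companion matrix of `f ^ n`. -/
def CRep (f : k[X]) (n : ℕ) [CharP k 2] : Representation k KleinFourGroup (CSpace f n) where
  toFun g := Matrix.toLin' (unipotentBlock (1 : Matrix (Idx f n) (Idx f n) k) ^ g.1.toAdd.val *
    unipotentBlock (companionPow f n) ^ g.2.toAdd.val)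
  map_one' := by simp [Module.End.one_eq_id]
  map_mul' g h := by
    have hc : Commute (unipotentBlock (companionPow f n))
        (unipotentBlock (1 : Matrix (Idx f n) (Idx f n) k)) := by
      simp [Commute, SemiconjBy, unipotentBlock_mul, add_comm]
    rw [Module.End.mul_eq_comp, ← Matrix.toLin'_mul]
    congr 1
    simp only [Prod.fst_mul, Prod.snd_mul, toAdd_mul, unipotentBlock_pow_val_add]
    have := (hc.pow_pow g.2.toAdd.val h.1.toAdd.val).eq
    simp only [mul_assoc]
    rw [← mul_assoc _ (unipotentBlock (1 : Matrix (Idx f n) (Idx f n) k) ^ h.1.toAdd.val)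
      (unipotentBlock (companionPow f n) ^ h.2.toAdd.val), this, mul_assoc]

end Module

/-! ### Hankel matrices -/

section Hankel

variable {K : Type*} [CommRing K]

/-- `H_i(x)`: the `n × n` matrix whose entries `(s, t)` with `s + t = i` (rows and columns
numbered from `1`) equal `x`, all other entries being zero. -/
def hankelUnit (n i : ℕ) (x : K) : Matrix (Fin n) (Fin n) K :=
  Matrix.of fun s t => if (s.val + 1) + (t.val + 1) = i then x else 0

/-- `H_{n+1}(1) + ∑ H_{n+i}(a_i)`, the sum over the even `i` with `2 ≤ i ≤ n`. -/
def hankelOf (n : ℕ) (a : ℕ → K) : Matrix (Fin n) (Fin n) K :=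
  hankelUnit n (n + 1) 1 + ∑ i ∈ (Finset.Icc 2 n).filter Even, hankelUnit n (n + i) (a i)

/-- The set `ℋ` of all matrices `hankelOf n a`. -/
def hankelSet (K : Type*) [CommRing K] (n : ℕ) : Set (Matrix (Fin n) (Fin n) K) :=
  Set.range (hankelOf n)

end Hankel

/-! ### The matrices `V`, `𝒟(X)` and `𝒱(X)` over a field containing the roots of `f` -/

section Jordan

variable {k E : Type*} [Field k] [Field E] [Algebra k E]

/-- The `k`-homomorphism `σ : k[ε] → E` that sends `ε` to the given root of `f`, where
`k[ε] = k[T]/(f)`. -/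
def rootHom (f : k[X]) (x : E) (hx : aeval x f = 0) : AdjoinRoot f →ₐ[k] E :=
  AdjoinRoot.liftAlgHom f (Algebra.ofId k E) x hx

/-- The Jordan block `J_n(α)`, with `α` on the diagonal and ones on the superdiagonal. -/
def jordanBlock (n : ℕ) (α : E) : Matrix (Fin n) (Fin n) E :=
  Matrix.of fun i j => if i = j then α else if i.val + 1 = j.val then 1 else 0

variable {m : ℕ}

/-- `J = diag(J_n(ε₁), …, J_n(ε_m))`; the pair `(q, t)` stands for the `q`-th index of the
`t`-th block. -/
def jordanMatrix (n : ℕ) (e : Fin m → E) : Matrix (Fin n × Fin m) (Fin n × Fin m) E :=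
  Matrix.blockDiagonal fun t => jordanBlock n (e t)

/-- The column vector `(e_n, …, e_n)`. -/
def firstColumn (m n : ℕ) : Fin n × Fin m → E := fun p => if p.1.val + 1 = n then 1 else 0

/-- The matrix `V` with first column `(e_n, …, e_n)` and with `J` times its `i`-th column as its
`(i+1)`-st column. -/
def changeOfBasis (n : ℕ) (e : Fin m → E) : Matrix (Fin n × Fin m) (Fin (m * n)) E :=
  Matrix.of fun r s => ((jordanMatrix n e ^ s.val).mulVec (firstColumn m n)) r

/-- `𝒱(X) = Vᵀ * diag(σ₁(X), …, σ_m(X)) * V`, where `σ_t : k[ε] → E` sends `ε` to the root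
`e t` of `f`. -/
def scriptV (f : k[X]) (n : ℕ) (e : Fin f.natDegree → E) (he : ∀ t, aeval (e t) f = 0)
    (X : Matrix (Fin n) (Fin n) (AdjoinRoot f)) : Matrix (Idx f n) (Idx f n) E :=
  (changeOfBasis n e).transpose *
    Matrix.blockDiagonal (fun t => X.map (rootHom f (e t) (he t))) * changeOfBasis n e

end Jordan

/-! ### The bilinear forms `S(A)` and the quadratic forms `Q_A(D)` -/

section Explicit

variable {k : Type*} [Field k] {ι : Type*} [Fintype ι] [DecidableEq ι]

/-- The bilinear form with Gram matrix `(0 W; W 0)`. -/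
def offDiagonalForm (W : Matrix ι ι k) : LinearMap.BilinForm k (ι ⊕ ι → k) :=
  Matrix.toBilin' (Matrix.fromBlocks 0 W W 0)

/-- The quadratic form `x ↦ xᵀ Q x` with `Q = (D_W W; 0 diag(d))`, where `D_W` is the diagonal
matrix with the same diagonal as `W`. -/
def upperQuadraticForm (W : Matrix ι ι k) (d : ι → k) : QuadraticForm k (ι ⊕ ι → k) :=
  (Matrix.fromBlocks (Matrix.diagonal W.diag) W 0 (Matrix.diagonal d)).toQuadraticForm'

end Explicit

/-- The two cases in which a `G`-invariant quadratic form with associated form `S(A)` exists. -/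
def QuadraticCase {k : Type*} [Field k] (f : k[X]) [Fact (Irreducible f)] (n : ℕ)
    (A : Matrix (Fin n) (Fin n) (AdjoinRoot f)) : Prop :=
  (Odd n ∧ (f = X ∨ f = X + 1) ∧
    A = if n = 1 then 1 else hankelUnit n (n + 1) 1 + hankelUnit n (n + 2) 1) ∨
  (Even n ∧ ¬ (f = X ∨ f = X + 1) ∧
    A = hankelOf n fun i => ((AdjoinRoot.root f + AdjoinRoot.root f ^ 2) ^ (i / 2))⁻¹)

end

/-! Put `K = k[T]/(f)` and `R = K[z]/(z^n)`. As `k` is perfect, `f` is separable, so `f(ε + z)` is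
`z` times a unit and `T ↦ ε + z` identifies `k[T]/(f^n)` with `R`. In the basis of powers of `τ = ε
+ z`, the companion matrix `Π` is multiplication by `τ`. Composing the coefficient of `z^(n-1)` with
the trace of `K/k` gives a functional `λ` on `R` for which `λ(ab)` is non-degenerate. Hence the
matrices commuting with `Π` are the multiplications by elements of `R`, and the matrices `Q` with
`Πᵀ Q = Q Π` are the Gram matrices of `(a, b) ↦ λ(cab)`, `c ∈ R` (`exists_eq_mul_of_commute`,
`exists_eq_gram`).

Endomorphisms of the module have blocks `(X Y; 0 X)` with `X` in `R`; since `R` is local, the module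
is indecomposable. An invariant symplectic form has blocks `(0 Q; Q Z)` with `Q` given by a unit `c`
and `Z` alternating. A suitable `Y` removes `Z`, and `X` changes `c` by the square of a unit. In
characteristic two, taking the even part of a series is linear over squares, and over a perfect
field the even part of a unit is itself the square of a unit. So `c` can be scaled to have even part
`1`, and is then unique modulo `z^n`. These normal forms `b` are exactly the series encoded by `ℋ`,
and `𝒱(A)` is the Gram matrix of `λ(b · ·)` because the rows of `V` list conjugates of the
coefficients of the powers of `ε + z`.

For quadratic forms, invariance under `g₁` fixes `q` on the first block, and `g₂` then requires
`λ(b(τ² + τ)u²) = 0` for all `u`. This kills every second coefficient of `b(τ² + τ)`, a recursion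
that yields the two cases. The remaining freedom is a diagonal `d`; the class of `∑ (W⁻¹)ᵢᵢ dᵢ`
modulo `{x² + x}` is a complete isometry invariant (`exists_sq_add_self_of_isometric`,
`isometric_of_sq_add_self`). -/

noncomputable section

/-! ### Invariant bilinear forms and module automorphisms as block matrices. -/

section MatrixForms

variable {k : Type*} [Field k]

theorem isometricForms_toBilin'_iff {G κ : Type*} [Group G] [Fintype κ] [DecidableEq κ]
    (ρ : Representation k G (κ → k)) (M M' : Matrix κ κ k) :
    IsometricForms ρ (Matrix.toBilin' M) (Matrix.toBilin' M') ↔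
      ∃ T : Matrix κ κ k, IsUnit T ∧
        (∀ g, T * LinearMap.toMatrix' (ρ g) = LinearMap.toMatrix' (ρ g) * T) ∧
        T.transpose * M * T = M' := by
  constructor
  · rintro ⟨α, hα, hB⟩
    refine ⟨LinearMap.toMatrix' α.toLinearMap, ?_, ?_, ?_⟩
    · refine IsUnit.of_mul_eq_one (LinearMap.toMatrix' α.symm.toLinearMap) ?_
      rw [← LinearMap.toMatrix'_comp, LinearEquiv.comp_symm, LinearMap.toMatrix'_id]
    · intro g
      rw [← LinearMap.toMatrix'_comp, ← LinearMap.toMatrix'_comp]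
      congr 1
      ext1 x
      exact LinearMap.ext fun c => hα g _
    · apply Matrix.toBilin'.injective
      refine LinearMap.ext fun x => LinearMap.ext fun y => ?_
      rw [← Matrix.toBilin'_comp, ← hB]
      simp
  · rintro ⟨T, ⟨u, rfl⟩, hT, rfl⟩
    refine ⟨LinearEquiv.ofLinearMap (Matrix.toLin' u.val) (Matrix.toLin' u.inv)
      (by rw [← Matrix.toLin'_mul, u.val_inv, Matrix.toLin'_one])
      (by rw [← Matrix.toLin'_mul, u.inv_val, Matrix.toLin'_one]), ?_, ?_⟩
    · intro g x
      have := congrArg (fun N => Matrix.toLin' N x) (hT g)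
      simpa [Matrix.toLin'_mul] using this
    · intro x y
      rw [← Matrix.toBilin'_comp]
      simp

theorem isometricForms_refl {G M : Type*} [Group G] [AddCommGroup M] [Module k M]
    (ρ : Representation k G M) (B : LinearMap.BilinForm k M) : IsometricForms ρ B B :=
  ⟨LinearEquiv.refl k M, fun _ _ => rfl, fun _ _ => rfl⟩

theorem IsometricForms.symm {G M : Type*} [Group G] [AddCommGroup M] [Module k M]
    {ρ : Representation k G M} {B B' : LinearMap.BilinForm k M} (h : IsometricForms ρ B B') :
    IsometricForms ρ B' B := by
  obtain ⟨α, hα, hB⟩ := h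
  refine ⟨α.symm, fun g x => ?_, fun x y => ?_⟩
  · rw [LinearEquiv.symm_apply_eq, hα, LinearEquiv.apply_symm_apply]
  · rw [← hB, LinearEquiv.apply_symm_apply, LinearEquiv.apply_symm_apply]

theorem IsometricForms.trans {G M : Type*} [Group G] [AddCommGroup M] [Module k M]
    {ρ : Representation k G M} {B B' B'' : LinearMap.BilinForm k M} (h : IsometricForms ρ B B')
    (h' : IsometricForms ρ B' B'') : IsometricForms ρ B B'' := by
  obtain ⟨α, hα, hB⟩ := h
  obtain ⟨β, hβ, hB'⟩ := h'
  refine ⟨β.trans α, fun g x => ?_, fun x y => ?_⟩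
  · simp only [LinearEquiv.trans_apply, hβ, hα]
  · simp only [LinearEquiv.trans_apply, hB, hB']

theorem IsFullSetOfReps.ncard_eq {α : Type*} {r : α → α → Prop} {C R R' : Set α}
    (hsymm : ∀ x y, r x y → r y x) (htrans : ∀ x y z, r x y → r y z → r x z)
    (hrefl : ∀ x, r x x)
    (hR : IsFullSetOfReps r C R) (hR' : IsFullSetOfReps r C R') : R.ncard = R'.ncard := by
  choose! φ hφ hu using hR'.2
  have key : ∀ x ∈ R, ∀ y ∈ R, r x y → x = y := fun x hx y hy h =>
    (hR.2 y (hR.1 hy)).unique ⟨hx, h⟩ ⟨hy, hrefl y⟩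
  refine Set.ncard_congr (fun x _ => φ x) (fun x hx => (hφ x (hR.1 hx)).1) ?_ ?_
  · intro x y hx hy h
    refine key x hx y hy (htrans _ (φ x) _ (hsymm _ _ (hφ x (hR.1 hx)).2) ?_)
    rw [h]
    exact (hφ y (hR.1 hy)).2
  · intro y hy
    obtain ⟨x, ⟨hx, hxy⟩, -⟩ := hR.2 y (hR'.1 hy)
    exact ⟨x, hx, ((hu x (hR.1 hx)) y ⟨hy, hsymm _ _ hxy⟩).symm⟩

theorem unipotentBlock_pow {ι : Type*} [DecidableEq ι] [Fintype ι] (P : Matrix ι ι k) (a : ℕ) :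
    unipotentBlock P ^ a = unipotentBlock (a • P) := by
  induction a with
  | zero => simp [unipotentBlock]
  | succ a ih => rw [pow_succ, ih, unipotentBlock_mul, succ_nsmul]

theorem toMatrix'_CRep [CharP k 2] (f : k[X]) (n : ℕ) (g : KleinFourGroup) :
    LinearMap.toMatrix' (CRep f n g) = unipotentBlock
      (g.1.toAdd.val • (1 : Matrix (Idx f n) (Idx f n) k) + g.2.toAdd.val • companionPow f n) := by
  change LinearMap.toMatrix' (Matrix.toLin' _) = _
  rw [LinearMap.toMatrix'_toLin', unipotentBlock_pow, unipotentBlock_pow, unipotentBlock_mul]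

theorem toMatrix'_CRep_fst [CharP k 2] (f : k[X]) (n : ℕ) :
    LinearMap.toMatrix' (CRep f n (Multiplicative.ofAdd 1, 1)) =
      unipotentBlock (1 : Matrix (Idx f n) (Idx f n) k) := by
  rw [toMatrix'_CRep]
  have : (1 : ZMod 2).val = 1 := rfl
  simp [this]

theorem toMatrix'_CRep_snd [CharP k 2] (f : k[X]) (n : ℕ) :
    LinearMap.toMatrix' (CRep f n (1, Multiplicative.ofAdd 1)) =
      unipotentBlock (companionPow f n) := by
  rw [toMatrix'_CRep]
  have : (1 : ZMod 2).val = 1 := rfl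
  simp [this]

/-- Comparing blocks, `g₁` forces the lower left block to vanish and the diagonal blocks to agree;
what `g₂` adds is only that `X` commutes with `Π`. -/
theorem commute_CRep_iff [CharP k 2] (f : k[X]) (n : ℕ)
    (T : Matrix (Idx f n ⊕ Idx f n) (Idx f n ⊕ Idx f n) k) :
    (∀ g, T * LinearMap.toMatrix' (CRep f n g) = LinearMap.toMatrix' (CRep f n g) * T) ↔
      ∃ X Y, T = Matrix.fromBlocks X Y 0 X ∧ X * companionPow f n = companionPow f n * X := by
  constructor
  · intro h
    have h1 := h (Multiplicative.ofAdd 1, 1)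
    have h2 := h (1, Multiplicative.ofAdd 1)
    rw [toMatrix'_CRep_fst] at h1
    rw [toMatrix'_CRep_snd] at h2
    rw [← Matrix.fromBlocks_toBlocks T] at h1 h2 ⊢
    simp only [unipotentBlock, Matrix.fromBlocks_multiply, Matrix.fromBlocks_inj, mul_one, mul_zero,
      add_zero, one_mul, zero_mul, zero_add] at h1 h2
    obtain ⟨h11, h12, -, -⟩ := h1
    obtain ⟨-, h22, -, -⟩ := h2
    have hZ : T.toBlocks₂₁ = 0 := by simpa using h11
    have hX : T.toBlocks₂₂ = T.toBlocks₁₁ := by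
      rw [add_comm, add_left_cancel_iff] at h12
      exact h12.symm
    refine ⟨T.toBlocks₁₁, T.toBlocks₁₂, by rw [hZ, hX], ?_⟩
    rw [hX, add_comm, add_left_cancel_iff] at h22
    exact h22
  · rintro ⟨X, Y, rfl, h⟩ g
    rw [toMatrix'_CRep]
    simp only [unipotentBlock, Matrix.fromBlocks_multiply, mul_add, add_mul, h, mul_smul_comm,
      smul_mul_assoc, mul_one, one_mul, mul_zero, zero_mul, add_zero, smul_zero, add_comm]

/-- The generator `g₁` gives `P = 0` and `Q + Q' = 0`; the lower right block for `g₂` gives `Πᵀ Q +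
Q Π = 0`. Signs disappear in characteristic two. -/
theorem isInvariantForm_CRep_iff [CharP k 2] (f : k[X]) (n : ℕ)
    (P Q Q' Z : Matrix (Idx f n) (Idx f n) k) :
    IsInvariantForm (CRep f n) (Matrix.toBilin' (Matrix.fromBlocks P Q Q' Z)) ↔
      P = 0 ∧ Q' = Q ∧ (companionPow f n).transpose * Q = Q * companionPow f n := by
  have hneg : ∀ A B : Matrix (Idx f n) (Idx f n) k, A + B = 0 ↔ B = A := by
    intro A B
    rw [← Matrix.ext_iff, ← Matrix.ext_iff]
    refine forall_congr' fun i => forall_congr' fun j => ?_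
    rw [Matrix.add_apply, Matrix.zero_apply, CharTwo.add_eq_zero, eq_comm]
  have key : ∀ M : Matrix (Idx f n ⊕ Idx f n) (Idx f n ⊕ Idx f n) k,
      IsInvariantForm (CRep f n) (Matrix.toBilin' M) ↔ ∀ g,
        (LinearMap.toMatrix' (CRep f n g)).transpose * M * LinearMap.toMatrix' (CRep f n g) = M := by
    intro M
    refine forall_congr' fun g => ?_
    rw [← Matrix.toBilin'.injective.eq_iff, ← Matrix.toBilin'_comp, Matrix.toLin'_toMatrix']
    constructor
    · intro h
      exact LinearMap.ext fun x => LinearMap.ext fun y => h x y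
    · intro h x y
      exact congrArg (fun B : LinearMap.BilinForm k _ => B x y) h
  rw [key]
  constructor
  · intro h
    have h1 := h (Multiplicative.ofAdd 1, 1)
    have h2 := h (1, Multiplicative.ofAdd 1)
    rw [toMatrix'_CRep_fst] at h1
    rw [toMatrix'_CRep_snd] at h2
    simp only [unipotentBlock, Matrix.fromBlocks_transpose, Matrix.fromBlocks_multiply,
      Matrix.fromBlocks_inj, mul_one, mul_zero, Matrix.transpose_one, Matrix.transpose_zero,
      add_zero, one_mul, zero_mul, true_and] at h1 h2
    obtain ⟨h11, h12, h13⟩ := h1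
    obtain ⟨-, -, h23⟩ := h2
    have hP : P = 0 := by simpa using h11
    subst hP
    have hQ : Q' = Q := by
      rw [zero_add, ← add_assoc, add_eq_right, add_comm, hneg] at h13
      exact h13
    subst hQ
    refine ⟨rfl, rfl, ?_⟩
    rw [mul_zero, zero_add, ← add_assoc, add_eq_right, hneg] at h23
    exact h23
  · rintro ⟨rfl, rfl, h⟩ g
    rw [toMatrix'_CRep]
    have h0 : ∀ A : Matrix (Idx f n) (Idx f n) k, A + A = 0 := fun A => (hneg A A).2 rfl
    simp only [unipotentBlock, Matrix.fromBlocks_transpose, Matrix.fromBlocks_multiply,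
      Matrix.fromBlocks_inj, mul_one, mul_zero, Matrix.transpose_one, Matrix.transpose_zero,
      add_zero, one_mul, zero_mul, true_and, zero_add, Matrix.transpose_add, Matrix.transpose_smul,
      add_mul, mul_add, smul_mul_assoc, mul_smul_comm, h]
    rw [← add_assoc, h0, zero_add]
    simp

/-- Swapping the two block columns produces a block triangular matrix with `Q` twice on the
diagonal. -/
theorem isUnit_fromBlocks_zero₁₁ {ι : Type*} [Fintype ι] [DecidableEq ι] (Q Z : Matrix ι ι k) :
    IsUnit (Matrix.fromBlocks 0 Q Q Z) ↔ IsUnit Q := by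
  have hS : (Matrix.fromBlocks 0 1 1 0 : Matrix (ι ⊕ ι) (ι ⊕ ι) k) * Matrix.fromBlocks 0 1 1 0 = 1 := by
    simp [Matrix.fromBlocks_multiply]
  let S : (Matrix (ι ⊕ ι) (ι ⊕ ι) k)ˣ := ⟨_, _, hS, hS⟩
  rw [← Units.isUnit_mul_units _ S]
  change IsUnit (Matrix.fromBlocks 0 Q Q Z * Matrix.fromBlocks 0 1 1 0) ↔ _
  simp [Matrix.fromBlocks_multiply]

theorem isAlt_toBilin'_iff {κ : Type*} [Fintype κ] [DecidableEq κ] [CharP k 2]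
    (M : Matrix κ κ k) :
    (Matrix.toBilin' M).IsAlt ↔ M.transpose = M ∧ ∀ i, M i i = 0 := by
  constructor
  · intro h
    refine ⟨?_, fun i => ?_⟩
    · ext i j
      have := h.neg_eq (Pi.single i 1) (Pi.single j 1)
      rw [Matrix.toBilin'_single, Matrix.toBilin'_single, CharTwo.neg_eq] at this
      exact this.symm
    · have := h.self_eq_zero (Pi.single i 1)
      rwa [Matrix.toBilin'_single] at this
  · rintro ⟨hs, hd⟩ x
    rw [Matrix.toBilin'_apply]
    rw [← Finset.sum_product']
    -- The terms at `(i, j)` and `(j, i)` are equal and cancel in pairs; the fixed points of the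
    -- swap are the diagonal terms, which vanish.
    refine Finset.sum_involution (fun p _ => p.swap) ?_ ?_ (fun _ _ => by simp) (fun _ _ => by simp)
    · rintro ⟨i, j⟩ -
      have : M j i = M i j := congrFun (congrFun hs i) j
      simp only [Prod.fst_swap, Prod.snd_swap, this]
      rw [mul_right_comm, mul_comm (x i), mul_right_comm, mul_right_comm (x j) (M i j)]
      exact CharTwo.add_self_eq_zero _
    · rintro ⟨i, j⟩ - hne heq
      simp only [Prod.swap_prod_mk, Prod.mk.injEq] at heq
      obtain ⟨rfl, -⟩ := heq
      simp [hd] at hne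

theorem isSymplectic_toBilin'_fromBlocks_iff {ι : Type*} [Fintype ι] [DecidableEq ι] [CharP k 2]
    (Q Z : Matrix ι ι k) :
    IsSymplectic (Matrix.toBilin' (Matrix.fromBlocks 0 Q Q Z)) ↔
      Q.transpose = Q ∧ IsUnit Q ∧ Z.transpose = Z ∧ ∀ i, Z i i = 0 := by
  rw [IsSymplectic, LinearMap.BilinForm.nondegenerate_toBilin'_iff_det_ne_zero,
    ← isUnit_iff_ne_zero, ← Matrix.isUnit_iff_isUnit_det, isUnit_fromBlocks_zero₁₁,
    isAlt_toBilin'_iff, Matrix.fromBlocks_transpose, Matrix.fromBlocks_inj]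
  simp
  tauto

theorem exists_add_transpose_eq {ι : Type*} [LinearOrder ι] (Z : Matrix ι ι k)
    (h : Z.transpose = Z) (h0 : ∀ i, Z i i = 0) : ∃ N : Matrix ι ι k, N + N.transpose = Z := by
  refine ⟨Matrix.of fun i j => if i < j then Z i j else 0, ?_⟩
  ext i j
  have : Z j i = Z i j := congrFun (congrFun h i) j
  rcases lt_trichotomy i j with hij | rfl | hij
  · simp [hij, hij.not_gt]
  · simp [h0]
  · simp [hij, hij.not_gt, this]

/-- The block `Z` never obstructs an isometry: write the alternating `Z` as `N + Nᵀ` and take `Y = X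
Q⁻¹ N`, so that `Xᵀ Q' Y = N` and the lower right block becomes `N + Nᵀ`. -/
theorem isometricForms_offDiagonalForm_iff [CharP k 2] (f : k[X]) (n : ℕ)
    (Q Q' Z : Matrix (Idx f n) (Idx f n) k) (hQ : Q.transpose = Q) (hQu : IsUnit Q)
    (hZ : Z.transpose = Z) (hZ0 : ∀ i, Z i i = 0) :
    IsometricForms (CRep f n) (offDiagonalForm Q')
      (Matrix.toBilin' (Matrix.fromBlocks 0 Q Q Z)) ↔
      ∃ X, IsUnit X ∧ X * companionPow f n = companionPow f n * X ∧
        X.transpose * Q' * X = Q := by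
  rw [offDiagonalForm, isometricForms_toBilin'_iff]
  constructor
  · rintro ⟨T, hTu, hT, h⟩
    obtain ⟨X, Y, rfl, hX⟩ := (commute_CRep_iff f n T).1 hT
    refine ⟨X, (Matrix.isUnit_fromBlocks_zero₂₁.1 hTu).1, hX, ?_⟩
    simp only [Matrix.fromBlocks_transpose, Matrix.fromBlocks_multiply, Matrix.fromBlocks_inj] at h
    simpa using h.2.1
  · rintro ⟨X, hXu, hX, h⟩
    obtain ⟨N, rfl⟩ := exists_add_transpose_eq Z hZ hZ0
    have hQd := (Matrix.isUnit_iff_isUnit_det _).1 hQu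
    refine ⟨Matrix.fromBlocks X (X * (Q⁻¹ * N)) 0 X, Matrix.isUnit_fromBlocks_zero₂₁.2 ⟨hXu, hXu⟩,
      (commute_CRep_iff f n _).2 ⟨_, _, rfl, hX⟩, ?_⟩
    have e1 : X.transpose * Q' * (X * (Q⁻¹ * N)) = N := by
      rw [← mul_assoc, h, Matrix.mul_nonsing_inv_cancel_left _ _ hQd]
    have e2 : (X * (Q⁻¹ * N)).transpose * Q' * X = N.transpose := by
      rw [Matrix.transpose_mul, mul_assoc, mul_assoc, ← mul_assoc _ Q', h, Matrix.transpose_mul,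
        Matrix.transpose_nonsing_inv, hQ, Matrix.nonsing_inv_mul_cancel_right _ _ hQd]
    rw [Matrix.fromBlocks_transpose, Matrix.fromBlocks_multiply, Matrix.fromBlocks_multiply]
    simp [-Matrix.transpose_mul, h, e1, e2, add_comm]

theorem isometricForms_offDiagonalForm_iff' [CharP k 2] (f : k[X]) (n : ℕ)
    (Q Q' : Matrix (Idx f n) (Idx f n) k) (hQ : Q.transpose = Q) (hQu : IsUnit Q) :
    IsometricForms (CRep f n) (offDiagonalForm Q') (offDiagonalForm Q) ↔
      ∃ X, IsUnit X ∧ X * companionPow f n = companionPow f n * X ∧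
        X.transpose * Q' * X = Q :=
  isometricForms_offDiagonalForm_iff f n Q Q' 0 hQ hQu (by simp) (by simp)

/-- `C_n(f)` is not an orthogonal sum once the commutant of the companion matrix has no
non-trivial idempotents. -/
theorem not_isOrthogonallyDecomposable_CRep [CharP k 2] (f : k[X]) (n : ℕ)
    (hid : ∀ X, X * companionPow f n = companionPow f n * X → X * X = X → X = 0 ∨ X = 1)
    (B : LinearMap.BilinForm k (CSpace f n)) : ¬ IsOrthogonallyDecomposable (CRep f n) B := by
  rintro ⟨N₁, N₂, h1, h2, hc, hN1, hN2, -⟩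
  set p := N₁.projection N₂ hc with hp
  have hpc : ∀ g, p ∘ₗ CRep f n g = CRep f n g ∘ₗ p := by
    intro g
    refine LinearMap.ext fun x => ?_
    obtain ⟨y, z, hy, hz, rfl⟩ : ∃ y z, y ∈ N₁ ∧ z ∈ N₂ ∧ y + z = x := by
      have : x ∈ N₁ ⊔ N₂ := by rw [hc.sup_eq_top]; trivial
      obtain ⟨y, hy, z, hz, h⟩ := Submodule.mem_sup.1 this
      exact ⟨y, z, hy, hz, h⟩
    have e1 : ∀ y ∈ N₁, p y = y := fun y hy => Submodule.projection_apply_left hc ⟨y, hy⟩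
    have e2 : ∀ y ∈ N₂, p y = 0 := fun y hy => (Submodule.projection_apply_eq_zero_iff hc).2 hy
    simp only [LinearMap.comp_apply, map_add, e1 _ hy, e2 _ hz, e1 _ (h1 g _ hy), e2 _ (h2 g _ hz),
      map_zero]
  have hpp : p ∘ₗ p = p := Submodule.isIdempotentElem_projection hc
  obtain ⟨X, Y, hT, hX⟩ := (commute_CRep_iff f n (LinearMap.toMatrix' p)).1 fun g => by
    rw [← LinearMap.toMatrix'_comp, ← LinearMap.toMatrix'_comp, hpc]
  have hTT : LinearMap.toMatrix' p * LinearMap.toMatrix' p = LinearMap.toMatrix' p := by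
    rw [← LinearMap.toMatrix'_comp, hpp]
  rw [hT, Matrix.fromBlocks_multiply, Matrix.fromBlocks_inj] at hTT
  simp only [mul_zero, add_zero, zero_mul, zero_add, true_and] at hTT
  obtain ⟨hXX, hXY, -⟩ := hTT
  -- The upper right block of idempotency reads `XY + YX = Y`. Both `X = 0` and `X = 1` then force
  -- `Y = 0`, so the projection is `0` or the identity.
  rcases hid X hX hXX with rfl | rfl
  · have : p = 0 := by
      apply LinearMap.toMatrix'.injective
      rw [hT, map_zero]
      have hY : Y = 0 := by simpa using hXY.symm
      simp [hY]
    apply hN2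
    rw [eq_top_iff]
    intro x _
    rw [← Submodule.projection_apply_eq_zero_iff hc, ← hp, this]
    rfl
  · have : p = LinearMap.id := by
      apply LinearMap.toMatrix'.injective
      rw [hT, LinearMap.toMatrix'_id]
      have hY : Y = 0 := by simpa using hXY
      simp [hY]
    apply hN1
    rw [eq_top_iff]
    intro x _
    have hx : p x = x := by rw [this]; rfl
    rw [← hx]
    exact Submodule.projection_apply_mem hc x

end MatrixForms

/-! ### Invariant quadratic forms and their Arf-type invariant. -/

section QuadraticForms

variable {k : Type*} [Field k]

/-- The off-diagonal part of a symmetric matrix is alternating in characteristic two, so only the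
diagonal contributes. -/
theorem dotProduct_mulVec_self [CharP k 2] {κ : Type*} [Fintype κ] [DecidableEq κ]
    {W : Matrix κ κ k} (hW : W.transpose = W) (x : κ → k) :
    x ⬝ᵥ W.mulVec x = ∑ i, W i i * x i ^ 2 := by
  have h : (Matrix.toBilin' (W - Matrix.diagonal W.diag)).IsAlt := by
    rw [isAlt_toBilin'_iff]
    exact ⟨by simp [hW], by simp⟩
  have := h.self_eq_zero x
  rw [Matrix.toBilin'_apply', Matrix.sub_mulVec, dotProduct_sub, sub_eq_zero] at this
  rw [this]
  simp only [dotProduct, Matrix.mulVec_diagonal, Matrix.diag_apply]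
  exact Finset.sum_congr rfl fun i _ => by ring

theorem dotProduct_mulVec_comm {κ : Type*} [Fintype κ]
    {W : Matrix κ κ k} (hW : W.transpose = W) (x y : κ → k) :
    x ⬝ᵥ W.mulVec y = y ⬝ᵥ W.mulVec x := by
  rw [Matrix.dotProduct_mulVec, ← Matrix.mulVec_transpose, hW, dotProduct_comm]

variable {ι : Type*} [Fintype ι] [DecidableEq ι]

theorem offDiagonalForm_elim (W : Matrix ι ι k) (x y x' y' : ι → k) :
    offDiagonalForm W (Sum.elim x y) (Sum.elim x' y') =
      x ⬝ᵥ W.mulVec y' + y ⬝ᵥ W.mulVec x' := by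
  rw [offDiagonalForm, Matrix.toBilin'_apply', Matrix.fromBlocks_mulVec]
  simp [sumElim_dotProduct_sumElim]

theorem forall_kleinFourGroup_apply_eq {M β : Type*} [AddCommGroup M] [Module k M]
    (ρ : Representation k KleinFourGroup M) (q : M → β)
    (h1 : ∀ x, q (ρ (Multiplicative.ofAdd 1, 1) x) = q x)
    (h2 : ∀ x, q (ρ (1, Multiplicative.ofAdd 1) x) = q x) (g : KleinFourGroup) (x : M) :
    q (ρ g x) = q x := by
  have hg : ∀ g : KleinFourGroup, g = 1 ∨ g = (Multiplicative.ofAdd 1, 1) ∨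
      g = (1, Multiplicative.ofAdd 1) ∨
      g = (Multiplicative.ofAdd 1, 1) * (1, Multiplicative.ofAdd 1) := by decide
  rcases hg g with rfl | rfl | rfl | rfl
  · simp
  · exact h1 x
  · exact h2 x
  · rw [map_mul, Module.End.mul_apply, h1, h2]

/-- A quadratic form with zero polar form is additive and scales by squares, hence is determined by
its values on a basis. -/
theorem eq_zero_of_polarBilin_eq_zero {M κ : Type*} [AddCommGroup M] [Module k M] [Fintype κ]
    (b : Module.Basis κ k M) {q : QuadraticForm k M} (h : QuadraticMap.polarBilin q = 0)
    (hb : ∀ i, q (b i) = 0) : q = 0 := by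
  have hadd : ∀ x y, q (x + y) = q x + q y := fun x y => by
    rw [QuadraticMap.map_add q]
    have := congrArg (fun B : LinearMap.BilinForm k M => B x y) h
    simp only [QuadraticMap.polarBilin_apply_apply, LinearMap.zero_apply] at this
    rw [this, add_zero]
  let φ : M →+ k := ⟨⟨q, QuadraticMap.map_zero q⟩, hadd⟩
  ext x
  change φ x = 0
  rw [← b.sum_repr x, map_sum]
  refine Finset.sum_eq_zero fun i _ => ?_
  change q _ = 0
  rw [QuadraticMap.map_smul, hb, smul_zero]

variable [CharP k 2]

theorem upperQuadraticForm_elim {W : Matrix ι ι k} (hW : W.transpose = W) (d x y : ι → k) :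
    upperQuadraticForm W d (Sum.elim x y) =
      x ⬝ᵥ W.mulVec x + x ⬝ᵥ W.mulVec y + ∑ i, d i * y i ^ 2 := by
  rw [upperQuadraticForm, Matrix.toQuadraticForm', LinearMap.BilinMap.toQuadraticMap_apply,
    Matrix.toLinearMap₂'_apply', Matrix.fromBlocks_mulVec, dotProduct_mulVec_self hW]
  simp only [Sum.elim_comp_inl, Sum.elim_comp_inr, Matrix.zero_mulVec, zero_add,
    sumElim_dotProduct_sumElim, dotProduct_add]
  have h : ∀ a b : ι → k, b ⬝ᵥ (Matrix.diagonal a).mulVec b = ∑ i, a i * b i ^ 2 := fun a b => by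
    simp only [dotProduct, Matrix.mulVec_diagonal]
    exact Finset.sum_congr rfl fun i _ => by ring
  rw [h, h]
  rfl

theorem polarBilin_upperQuadraticForm {W : Matrix ι ι k} (hW : W.transpose = W) (d : ι → k) :
    QuadraticMap.polarBilin (upperQuadraticForm W d) = offDiagonalForm W := by
  refine LinearMap.ext fun v => LinearMap.ext fun w => ?_
  rw [← Sum.elim_comp_inl_inr v, ← Sum.elim_comp_inl_inr w, offDiagonalForm_elim]
  set x := v ∘ Sum.inl
  set y := v ∘ Sum.inr
  set x' := w ∘ Sum.inl
  set y' := w ∘ Sum.inr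
  have h : Sum.elim x y + Sum.elim x' y' = Sum.elim (x + x') (y + y') := by
    ext (i | i) <;> simp
  rw [QuadraticMap.polarBilin_apply_apply, QuadraticMap.polar, h, upperQuadraticForm_elim hW,
    upperQuadraticForm_elim hW, upperQuadraticForm_elim hW]
  simp only [Pi.add_apply, CharTwo.add_sq, mul_add, Finset.sum_add_distrib, Matrix.mulVec_add,
    dotProduct_add, add_dotProduct, dotProduct_mulVec_comm hW x' x, dotProduct_mulVec_comm hW x' y]
  linear_combination CharTwo.add_self_eq_zero (x ⬝ᵥ W.mulVec x')

theorem CRep_fst_elim (f : k[X]) (n : ℕ) (x y : Idx f n → k) :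
    CRep f n (Multiplicative.ofAdd 1, 1) (Sum.elim x y) = Sum.elim (x + y) y := by
  rw [← Matrix.toLin'_toMatrix' (CRep f n (Multiplicative.ofAdd 1, 1)), toMatrix'_CRep_fst,
    Matrix.toLin'_apply, unipotentBlock, Matrix.fromBlocks_mulVec]
  simp

theorem CRep_snd_elim (f : k[X]) (n : ℕ) (x y : Idx f n → k) :
    CRep f n (1, Multiplicative.ofAdd 1) (Sum.elim x y) =
      Sum.elim (x + (companionPow f n).mulVec y) y := by
  rw [← Matrix.toLin'_toMatrix' (CRep f n (1, Multiplicative.ofAdd 1)), toMatrix'_CRep_snd,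
    Matrix.toLin'_apply, unipotentBlock, Matrix.fromBlocks_mulVec]
  simp

/-- Applying `g₁` to `(0, y)` forces `q(y, 0) = yᵀ W y`, which leaves only the values `dᵢ = q(0,
eᵢ)` free. Applying `g₂` to `(0, y)` gives the condition on `W`, in which `d` no longer appears. -/
theorem mem_invariantQuadraticForms_iff (f : k[X]) (n : ℕ) {W : Matrix (Idx f n) (Idx f n) k}
    (hW : W.transpose = W) (q : QuadraticForm k (CSpace f n)) :
    q ∈ InvariantQuadraticForms (CRep f n) (offDiagonalForm W) ↔
      (∀ y, (companionPow f n).mulVec y ⬝ᵥ W.mulVec ((companionPow f n).mulVec y) =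
        (companionPow f n).mulVec y ⬝ᵥ W.mulVec y) ∧ ∃ d, upperQuadraticForm W d = q := by
  constructor
  · rintro ⟨hinv, hpol⟩
    have hq : ∃ d, upperQuadraticForm W d = q := by
      have hsum : ∀ x y : Idx f n → k, q (Sum.elim x y) =
          q (Sum.elim x 0) + q (Sum.elim 0 y) + x ⬝ᵥ W.mulVec y := by
        intro x y
        have e : Sum.elim x y =
            Sum.elim x 0 + Sum.elim (0 : Idx f n → k) y := by
          ext (i | i) <;> simp
        rw [e, QuadraticMap.map_add q, ← QuadraticMap.polarBilin_apply_apply, hpol,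
          offDiagonalForm_elim]
        simp
      have hx : ∀ y : Idx f n → k, q (Sum.elim y 0) = y ⬝ᵥ W.mulVec y := by
        intro y
        have h := hinv (Multiplicative.ofAdd 1, 1) (Sum.elim 0 y)
        rw [CRep_fst_elim, zero_add, hsum] at h
        rw [← CharTwo.add_eq_zero]
        linear_combination h
      refine ⟨fun i => q (Sum.elim 0 (Pi.single i 1)), ?_⟩
      rw [← sub_eq_zero]
      refine eq_zero_of_polarBilin_eq_zero (Pi.basisFun k _) ?_ ?_
      · refine LinearMap.ext fun v => LinearMap.ext fun w => ?_
        have h1 := congrArg (fun B : LinearMap.BilinForm k _ => B v w) hpol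
        have h2 := congrArg (fun B : LinearMap.BilinForm k _ => B v w)
          (polarBilin_upperQuadraticForm hW fun i => q (Sum.elim 0 (Pi.single i 1)))
        simp only [QuadraticMap.polarBilin_apply_apply, QuadraticMap.polar] at h1 h2 ⊢
        simp only [sub_apply, LinearMap.zero_apply]
        linear_combination h2 - h1
      · rintro (i | i)
        · have e : (Pi.basisFun k (Idx f n ⊕ Idx f n)) (Sum.inl i) =
              (Sum.elim (Pi.single i 1) 0 : Idx f n ⊕ Idx f n → k) := by
            rw [Pi.basisFun_apply, Sum.elim_single_zero]
          rw [e, sub_apply, upperQuadraticForm_elim hW, hx]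
          simp
        · have e : (Pi.basisFun k (Idx f n ⊕ Idx f n)) (Sum.inr i) =
              (Sum.elim 0 (Pi.single i 1) : Idx f n ⊕ Idx f n → k) := by
            rw [Pi.basisFun_apply, Sum.elim_zero_single]
          rw [e, sub_apply, upperQuadraticForm_elim hW]
          simp [Pi.single_apply]
    refine ⟨fun y => ?_, hq⟩
    obtain ⟨d, rfl⟩ := hq
    have h := hinv (1, Multiplicative.ofAdd 1) (Sum.elim 0 y)
    rw [CRep_snd_elim, upperQuadraticForm_elim hW, upperQuadraticForm_elim hW] at h
    rw [← CharTwo.add_eq_zero]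
    simp only [zero_add, zero_dotProduct] at h
    linear_combination h
  · rintro ⟨h, d, rfl⟩
    refine ⟨?_, polarBilin_upperQuadraticForm hW d⟩
    refine forall_kleinFourGroup_apply_eq (CRep f n) _ (fun v => ?_) (fun v => ?_)
    · rw [← Sum.elim_comp_inl_inr v, CRep_fst_elim, upperQuadraticForm_elim hW,
        upperQuadraticForm_elim hW]
      simp only [Matrix.mulVec_add, add_dotProduct, dotProduct_add]
      rw [dotProduct_mulVec_comm hW (v ∘ Sum.inr) (v ∘ Sum.inl)]
      linear_combination CharTwo.add_self_eq_zero ((v ∘ Sum.inr) ⬝ᵥ W.mulVec (v ∘ Sum.inr)) +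
        CharTwo.add_self_eq_zero ((v ∘ Sum.inl) ⬝ᵥ W.mulVec (v ∘ Sum.inr))
    · rw [← Sum.elim_comp_inl_inr v, CRep_snd_elim, upperQuadraticForm_elim hW,
        upperQuadraticForm_elim hW]
      simp only [Matrix.mulVec_add, add_dotProduct, dotProduct_add, h]
      set y := v ∘ Sum.inr
      set x := v ∘ Sum.inl
      set z := (companionPow f n).mulVec y
      rw [dotProduct_mulVec_comm hW z x]
      linear_combination CharTwo.add_self_eq_zero (x ⬝ᵥ W.mulVec z) +
        CharTwo.add_self_eq_zero (z ⬝ᵥ W.mulVec y)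

/-- The mixed terms cancel by symmetry. This identity turns the change of the invariant below into
an expression `r² + r`. -/
theorem sum_sum_mul_sq {Z : Matrix ι ι k} (hZ : Z.transpose = Z) (p : ι → k) :
    ∑ i, p i * ∑ j, p j * Z i j ^ 2 = (∑ i, p i * Z i i) ^ 2 := by
  have h : (Z.map fun x => x ^ 2).transpose = Z.map fun x => x ^ 2 := by
    rw [← Matrix.transpose_map, hZ]
  have := dotProduct_mulVec_self h p
  rw [CharTwo.sum_sq]
  simp only [dotProduct, Matrix.mulVec, Matrix.map_apply] at this
  simp only [mul_pow]
  rw [← Finset.sum_congr rfl fun i _ => mul_comm (Z i i ^ 2) (p i ^ 2), ← this]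
  exact Finset.sum_congr rfl fun i _ => by
    congr 1; exact Finset.sum_congr rfl fun i _ => by ring

/-- Let the isometry have blocks `(X Y; 0 X)`. Then `M = Yᵀ W X` is symmetric, and evaluation at
`(0, eᵢ)` expresses `d'ᵢ` as `∑ⱼ (W⁻¹)ⱼⱼ Mᵢⱼ² + Mᵢᵢ + ∑ⱼ dⱼ Xⱼᵢ²`. Weighting by `(W⁻¹)ᵢᵢ` and
summing, the first two parts give `r² + r` with `r = ∑ (W⁻¹)ᵢᵢ Mᵢᵢ`, and the last gives the
invariant of `d`. -/
theorem exists_sq_add_self_of_isometric (f : k[X]) (n : ℕ) {W : Matrix (Idx f n) (Idx f n) k}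
    (hW : W.transpose = W) (hWu : IsUnit W) {d d' : Idx f n → k}
    (h : IsometricQuadraticForms (CRep f n) (upperQuadraticForm W d) (upperQuadraticForm W d')) :
    ∃ r, ∑ i, W⁻¹ i i * d i - ∑ i, W⁻¹ i i * d' i = r ^ 2 + r := by
  obtain ⟨α, hα, hq⟩ := h
  have hWd := (Matrix.isUnit_iff_isUnit_det _).1 hWu
  obtain ⟨X, Y, hT, hX⟩ := (commute_CRep_iff f n (LinearMap.toMatrix' α.toLinearMap)).1 fun g => by
    rw [← LinearMap.toMatrix'_comp, ← LinearMap.toMatrix'_comp]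
    congr 1
    exact LinearMap.ext fun x => hα g x
  have hαe : ∀ x y, α (Sum.elim x y) = Sum.elim (X.mulVec x + Y.mulVec y) (X.mulVec y) := by
    intro x y
    have : α (Sum.elim x y) = Matrix.toLin' (LinearMap.toMatrix' α.toLinearMap) (Sum.elim x y) := by
      rw [Matrix.toLin'_toMatrix']; rfl
    rw [this, hT, Matrix.toLin'_apply, Matrix.fromBlocks_mulVec]
    simp
  have hpol : ∀ v w, offDiagonalForm W (α v) (α w) = offDiagonalForm W v w := by
    intro v w
    rw [← polarBilin_upperQuadraticForm hW d]
    conv_rhs => rw [polarBilin_upperQuadraticForm hW d, ← polarBilin_upperQuadraticForm hW d']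
    simp only [QuadraticMap.polarBilin_apply_apply, QuadraticMap.polar, ← hq, map_add]
  have hXW : X.transpose * W * X = W := by
    refine Matrix.toBilin'.injective (LinearMap.ext fun x => LinearMap.ext fun y => ?_)
    have := hpol (Sum.elim x 0) (Sum.elim 0 y)
    rw [hαe, hαe, offDiagonalForm_elim, offDiagonalForm_elim] at this
    rw [← Matrix.toBilin'_comp]
    simpa [Matrix.toBilin'_apply'] using this
  set M := Y.transpose * W * X with hM
  have hMs : M.transpose = M := by
    refine Matrix.toBilin'.injective (LinearMap.ext fun x => LinearMap.ext fun y => ?_)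
    have := hpol (Sum.elim 0 x) (Sum.elim 0 y)
    rw [hαe, hαe, offDiagonalForm_elim, offDiagonalForm_elim] at this
    simp only [Matrix.mulVec_zero, zero_add, zero_dotProduct, dotProduct_zero, add_zero] at this
    rw [hM, Matrix.transpose_mul, Matrix.transpose_mul, Matrix.transpose_transpose, ← mul_assoc, hW,
      ← Matrix.toBilin'_comp, ← Matrix.toBilin'_comp]
    simp only [LinearMap.BilinForm.comp_apply, Matrix.toBilin'_apply', Matrix.toLin'_apply]
    rw [CharTwo.add_eq_zero] at this
    exact this.symm
  have hPs : W⁻¹.transpose = W⁻¹ := by rw [Matrix.transpose_nonsing_inv, hW]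
  have hXu : IsUnit X.det := by
    have := congrArg Matrix.det hXW
    rw [Matrix.det_mul] at this
    rw [← this] at hWd
    exact isUnit_of_mul_isUnit_right hWd
  -- Inverting `Xᵀ W X = W` shows that `Xᵀ` preserves `W⁻¹`; this allows `Yᵀ W Y` to be written in
  -- terms of `M` alone.
  have hXP : X * W⁻¹ * X.transpose = W⁻¹ := by
    have hXt : IsUnit X.transpose.det := by rwa [Matrix.det_transpose]
    conv_lhs => rw [← hXW]
    rw [Matrix.mul_inv_rev, Matrix.mul_inv_rev, ← mul_assoc, Matrix.mul_nonsing_inv _ hXu, one_mul,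
      mul_assoc, Matrix.nonsing_inv_mul _ hXt, mul_one]
  have hYY : Y.transpose * W * Y = M * W⁻¹ * M.transpose := by
    have : M * W⁻¹ * M.transpose =
        Y.transpose * W * (X * W⁻¹ * X.transpose) * (W * Y) := by
      rw [hM, Matrix.transpose_mul, Matrix.transpose_mul, Matrix.transpose_transpose, hW]
      simp only [mul_assoc]
    rw [this, hXP, Matrix.mul_nonsing_inv_cancel_right _ _ hWd, mul_assoc]
  have hrow : ∀ (A : Matrix (Idx f n) (Idx f n) k) i,
      (A * W⁻¹ * A.transpose) i i = ∑ j, W⁻¹ j j * A i j ^ 2 := by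
    intro A i
    rw [← dotProduct_mulVec_self hPs (A i), mul_assoc, Matrix.mul_apply']
    rfl
  have hd : ∀ i, d' i = ∑ j, W⁻¹ j j * M i j ^ 2 + M i i + ∑ j, d j * X j i ^ 2 := by
    intro i
    have := hq (Sum.elim 0 (Pi.single i 1))
    rw [hαe, upperQuadraticForm_elim hW, upperQuadraticForm_elim hW] at this
    simp only [Matrix.mulVec_zero, zero_add, zero_dotProduct, Pi.single_apply] at this
    rw [← hrow, ← hYY]
    have hc : ∀ A B : Matrix (Idx f n) (Idx f n) k,
        (A.transpose * W * B) i i = A.mulVec (Pi.single i 1) ⬝ᵥ W.mulVec (B.mulVec (Pi.single i 1)) := by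
      intro A B
      rw [Matrix.mulVec_single_one, Matrix.mulVec_single_one, mul_assoc, Matrix.mul_apply']
      rfl
    rw [hM, hc, hc]
    simp only [Matrix.mulVec_single_one] at this ⊢
    simpa using this.symm
  refine ⟨∑ i, W⁻¹ i i * M i i, ?_⟩
  rw [CharTwo.sub_eq_add, ← sum_sum_mul_sq hMs]
  have h3 : ∑ i, W⁻¹ i i * ∑ j, d j * X j i ^ 2 = ∑ i, W⁻¹ i i * d i := by
    simp only [Finset.mul_sum]
    rw [Finset.sum_comm]
    refine Finset.sum_congr rfl fun j _ => ?_
    conv_rhs => rw [← hXP, hrow, Finset.sum_mul]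
    exact Finset.sum_congr rfl fun i _ => by ring
  simp only [hd, mul_add, Finset.sum_add_distrib, h3]
  linear_combination CharTwo.add_self_eq_zero (∑ i, W⁻¹ i i * d i)

/-- Automorphisms with `X = 1` and `Y = W⁻¹ M` suffice, for a symmetric `M` that solves `∑ⱼ (W⁻¹)ⱼⱼ
Mᵢⱼ² + Mᵢᵢ = dᵢ + d'ᵢ`. -/
theorem isometric_of_sq_add_self (f : k[X]) (n : ℕ) [PerfectField k]
    {W : Matrix (Idx f n) (Idx f n) k}
    (hW : W.transpose = W) (hWu : IsUnit W) {d d' : Idx f n → k} {t : Idx f n}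
    (ht : W⁻¹ t t ≠ 0) {r : k}
    (h : ∑ i, W⁻¹ i i * d i - ∑ i, W⁻¹ i i * d' i = r ^ 2 + r) :
    IsometricQuadraticForms (CRep f n) (upperQuadraticForm W d) (upperQuadraticForm W d') := by
  have hWd := (Matrix.isUnit_iff_isUnit_det _).1 hWu
  have hPs : W⁻¹.transpose = W⁻¹ := by rw [Matrix.transpose_nonsing_inv, hW]
  have hsq : ∀ x : k, ∃ y, y ^ 2 = x := fun x => by
    have := PerfectField.toPerfectRing (K := k) 2
    exact surjective_frobenius k 2 x
  choose s hs using hsq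
  set p := W⁻¹ t t with hp
  -- `M` is supported on row and column `t`. A row `i ≠ t` gives `p cᵢ² = dᵢ + d'ᵢ`, solved by a
  -- square root; after multiplication by `p`, row `t` becomes the hypothesis on `r` when `c_t = r /
  -- p`.
  let c : Idx f n → k := fun i => if i = t then r / p else s ((d i + d' i) / p)
  let M : Matrix (Idx f n) (Idx f n) k := Matrix.of fun i j =>
    if j = t then c i else if i = t then c j else 0
  have hMs : M.transpose = M := by
    ext i j
    simp only [M, Matrix.transpose_apply, Matrix.of_apply]
    by_cases hi : i = t <;> by_cases hj : j = t <;> simp [hi, hj]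
  have hd : ∀ i, ∑ j, W⁻¹ j j * M i j ^ 2 + M i i = d i + d' i := by
    intro i
    by_cases hi : i = t
    · subst hi
      rw [CharTwo.sub_eq_add, ← Finset.sum_add_distrib, ← Finset.add_sum_erase _ _ (Finset.mem_univ i)] at h
      rw [← Finset.add_sum_erase _ _ (Finset.mem_univ i)]
      have e : ∀ j ∈ Finset.univ.erase i, W⁻¹ j j * M i j ^ 2 =
          (W⁻¹ j j * d j + W⁻¹ j j * d' j) / p := by
        intro j hj
        have hj' := Finset.ne_of_mem_erase hj
        simp only [M, c, Matrix.of_apply, hj', if_false, if_true, hs]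
        ring
      rw [Finset.sum_congr rfl e, ← Finset.sum_div]
      simp only [M, c, Matrix.of_apply, if_true, ← hp] at h ⊢
      set w := ∑ x ∈ Finset.univ.erase i, (W⁻¹ x x * d x + W⁻¹ x x * d' x)
      field_simp
      linear_combination CharTwo.add_self_eq_zero w - h
    · rw [Finset.sum_eq_single t]
      · simp only [M, c, Matrix.of_apply, if_true, hi, if_false, hs, ← hp]
        field_simp
        simp
      · intro j _ hj
        simp [M, hi, hj]
      · simp
  obtain ⟨u, hu⟩ : IsUnit (Matrix.fromBlocks 1 (W⁻¹ * M) 0 1) :=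
    Matrix.isUnit_fromBlocks_zero₂₁.2 ⟨isUnit_one, isUnit_one⟩
  have hcomm := (commute_CRep_iff f n u.val).2 ⟨1, W⁻¹ * M, hu, by simp⟩
  refine ⟨LinearEquiv.ofLinearMap (Matrix.toLin' u.val) (Matrix.toLin' u.inv)
      (by rw [← Matrix.toLin'_mul, u.val_inv, Matrix.toLin'_one])
      (by rw [← Matrix.toLin'_mul, u.inv_val, Matrix.toLin'_one]), ?_, ?_⟩
  · intro g x
    have := congrArg (fun N => Matrix.toLin' N x) (hcomm g)
    simpa [Matrix.toLin'_mul] using this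
  · intro v
    have hα : Matrix.toLin' u.val v = Sum.elim (v ∘ Sum.inl + (W⁻¹ * M).mulVec (v ∘ Sum.inr))
        (v ∘ Sum.inr) := by
      rw [hu, Matrix.toLin'_apply, Matrix.fromBlocks_mulVec]
      simp
    change upperQuadraticForm W d (Matrix.toLin' u.val v) = _
    rw [hα]
    conv_rhs => rw [← Sum.elim_comp_inl_inr v]
    set x := v ∘ Sum.inl
    set y := v ∘ Sum.inr
    set z := (W⁻¹ * M).mulVec y with hz
    have hWz : W.mulVec z = M.mulVec y := by
      rw [hz, Matrix.mulVec_mulVec, Matrix.mul_nonsing_inv_cancel_left _ _ hWd]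
    have hzz : z ⬝ᵥ W.mulVec z = ∑ i, (∑ j, W⁻¹ j j * M i j ^ 2) * y i ^ 2 := by
      have hS : (M * W⁻¹ * M.transpose).transpose = M * W⁻¹ * M.transpose := by
        simp only [Matrix.transpose_mul, Matrix.transpose_transpose, hPs, mul_assoc]
      have e : z ⬝ᵥ W.mulVec z = y ⬝ᵥ (M * W⁻¹ * M.transpose).mulVec y := by
        rw [hWz, dotProduct_mulVec_comm hMs, hz, Matrix.mulVec_mulVec, hMs, mul_assoc]
      rw [e, dotProduct_mulVec_self hS]
      refine Finset.sum_congr rfl fun i _ => ?_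
      rw [← dotProduct_mulVec_self hPs (M i), mul_assoc, Matrix.mul_apply']
      rfl
    have hzy : z ⬝ᵥ W.mulVec y = ∑ i, M i i * y i ^ 2 := by
      rw [dotProduct_mulVec_comm hW, hWz, dotProduct_mulVec_self hMs]
    have hsum : ∑ i, (∑ j, W⁻¹ j j * M i j ^ 2) * y i ^ 2 + ∑ i, M i i * y i ^ 2 =
        ∑ i, d i * y i ^ 2 + ∑ i, d' i * y i ^ 2 := by
      rw [← Finset.sum_add_distrib, ← Finset.sum_add_distrib]
      exact Finset.sum_congr rfl fun i _ => by rw [← add_mul, hd, add_mul]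
    rw [upperQuadraticForm_elim hW, upperQuadraticForm_elim hW]
    simp only [Matrix.mulVec_add, add_dotProduct, dotProduct_add, hzz, hzy]
    rw [dotProduct_mulVec_comm hW z x]
    linear_combination hsum + CharTwo.add_self_eq_zero (x ⬝ᵥ W.mulVec z) +
      CharTwo.add_self_eq_zero (∑ i, d i * y i ^ 2)

end QuadraticForms

/-! ### The commutant of a generator. -/

section Commutant

variable {k ι R : Type*} [Field k] [Fintype ι] [CommRing R] [Algebra k R]
  {Ψ : (ι → k) ≃ₗ[k] R} {P : Matrix ι ι k} {τ : R}

/-- Since `τ` generates `R`, commuting with `P` means being `R`-linear, and an `R`-linear map of `R`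
is multiplication by its value at `1`. -/
theorem exists_eq_mul_of_commute (hP : ∀ x, Ψ (P.mulVec x) = τ * Ψ x)
    (hτ : Algebra.adjoin k {τ} = ⊤) {X : Matrix ι ι k} (hX : X * P = P * X) :
    ∃ w, ∀ x, Ψ (X.mulVec x) = w * Ψ x := by
  have key : ∀ r : R, ∀ x, Ψ (X.mulVec (Ψ.symm (r * x))) = r * Ψ (X.mulVec (Ψ.symm x)) := by
    intro r
    have hr : r ∈ Algebra.adjoin k {τ} := by rw [hτ]; trivial
    induction hr using Algebra.adjoin_induction with
    | mem r hr =>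
      intro x
      obtain rfl : r = τ := hr
      have e : Ψ.symm (r * x) = P.mulVec (Ψ.symm x) := by
        rw [LinearEquiv.symm_apply_eq, hP, LinearEquiv.apply_symm_apply]
      rw [e, Matrix.mulVec_mulVec, hX, ← Matrix.mulVec_mulVec, hP]
    | algebraMap c =>
      intro x
      simp only [← Algebra.smul_def, map_smul, Matrix.mulVec_smul]
    | add r s _ _ hr hs =>
      intro x
      rw [add_mul, map_add, Matrix.mulVec_add, map_add, hr, hs, add_mul]
    | mul r s _ _ hr hs =>
      intro x
      rw [mul_assoc, hr, hs, mul_assoc]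
  refine ⟨Ψ (X.mulVec (Ψ.symm 1)), fun x => ?_⟩
  have := key (Ψ x) 1
  rwa [mul_one, LinearEquiv.symm_apply_apply, mul_comm] at this

end Commutant

/-! ### Gram matrices of the forms `lam (c * a * b)`. -/

section Gram

variable {k ι R : Type*} [Field k] [DecidableEq ι] [CommRing R] [Algebra k R]
  (Ψ : (ι → k) ≃ₗ[k] R) (lam : R →ₗ[k] k)

/-- The Gram matrix of `(a, b) ↦ lam (c * a * b)` in coordinates given by `Ψ`. -/
def gram (c : R) : Matrix ι ι k :=
  Matrix.of fun i j => lam (c * (Ψ (Pi.single i 1) * Ψ (Pi.single j 1)))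

theorem gram_transpose (c : R) : (gram Ψ lam c).transpose = gram Ψ lam c := by
  ext i j
  simp only [gram, Matrix.transpose_apply, Matrix.of_apply, mul_comm (Ψ (Pi.single j 1))]

variable [Fintype ι]

/-- The matrix of multiplication by `w` in coordinates given by `Ψ`. -/
def mulMatrix (w : R) : Matrix ι ι k :=
  LinearMap.toMatrix' (Ψ.symm.toLinearMap ∘ₗ LinearMap.mulLeft k w ∘ₗ Ψ.toLinearMap)

theorem dotProduct_gram_mulVec (c : R) (x y : ι → k) :
    x ⬝ᵥ (gram Ψ lam c).mulVec y = lam (c * (Ψ x * Ψ y)) := by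
  let B : LinearMap.BilinForm k (ι → k) :=
    ((LinearMap.mul k R).compr₂ (lam ∘ₗ LinearMap.mulLeft k c)).compl₁₂ Ψ.toLinearMap Ψ.toLinearMap
  have h : gram Ψ lam c = LinearMap.BilinForm.toMatrix' B := by
    ext i j
    rw [LinearMap.BilinForm.toMatrix'_apply]
    rfl
  rw [h, ← Matrix.toBilin'_apply', Matrix.toBilin'_toMatrix']
  rfl

theorem mulMatrix_mulVec (w : R) (x : ι → k) :
    Ψ ((mulMatrix Ψ w).mulVec x) = w * Ψ x := by
  rw [mulMatrix, ← Matrix.toLin'_apply, Matrix.toLin'_toMatrix']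
  simp

theorem matrix_ext_dotProduct {A B : Matrix ι ι k}
    (h : ∀ x y, x ⬝ᵥ A.mulVec y = x ⬝ᵥ B.mulVec y) : A = B := by
  refine Matrix.toBilin'.injective (LinearMap.ext fun x => LinearMap.ext fun y => ?_)
  rw [Matrix.toBilin'_apply', Matrix.toBilin'_apply', h]

theorem transpose_mul_gram_mul (c : R) {X Y : Matrix ι ι k} {v w : R}
    (hX : ∀ x, Ψ (X.mulVec x) = v * Ψ x) (hY : ∀ x, Ψ (Y.mulVec x) = w * Ψ x) :
    X.transpose * gram Ψ lam c * Y = gram Ψ lam (c * (v * w)) := by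
  refine matrix_ext_dotProduct fun x y => ?_
  rw [← Matrix.mulVec_mulVec, ← Matrix.mulVec_mulVec, Matrix.dotProduct_mulVec,
    Matrix.vecMul_transpose, dotProduct_gram_mulVec, dotProduct_gram_mulVec, hX, hY]
  congr 1
  ring

theorem matrix_ext_of_equiv {A B : Matrix ι ι k} (h : ∀ x, Ψ (A.mulVec x) = Ψ (B.mulVec x)) :
    A = B := Matrix.toLin'.injective (LinearMap.ext fun x => Ψ.injective (h x))

theorem isUnit_mulMatrix {w : R} (hw : IsUnit w) : IsUnit (mulMatrix Ψ w) := by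
  obtain ⟨u, rfl⟩ := hw
  refine IsUnit.of_mul_eq_one (mulMatrix Ψ u.inv) (matrix_ext_of_equiv Ψ fun x => ?_)
  rw [← Matrix.mulVec_mulVec, mulMatrix_mulVec, mulMatrix_mulVec, ← mul_assoc, Units.inv_eq_val_inv,
    Units.mul_inv, one_mul, Matrix.one_mulVec]

variable {Ψ lam}

theorem gram_injective (hlam : ∀ a, (∀ b, lam (a * b) = 0) → a = 0) :
    Function.Injective (gram Ψ lam) := by
  intro c c' h
  rw [← sub_eq_zero]
  refine hlam _ fun b => ?_
  have := congrArg (fun A => (Ψ.symm 1) ⬝ᵥ A.mulVec (Ψ.symm b)) h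
  simp only [dotProduct_gram_mulVec, LinearEquiv.apply_symm_apply, one_mul] at this
  rw [sub_mul, map_sub, this, sub_self]

variable {P : Matrix ι ι k} {τ : R}

theorem mulMatrix_commute (hP : ∀ x, Ψ (P.mulVec x) = τ * Ψ x) (w : R) :
    mulMatrix Ψ w * P = P * mulMatrix Ψ w := by
  refine matrix_ext_of_equiv Ψ fun x => ?_
  rw [← Matrix.mulVec_mulVec, ← Matrix.mulVec_mulVec, mulMatrix_mulVec, hP, hP, mulMatrix_mulVec]
  ring

theorem transpose_mul_gram (hP : ∀ x, Ψ (P.mulVec x) = τ * Ψ x) (c : R) :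
    P.transpose * gram Ψ lam c = gram Ψ lam c * P := by
  have h1 : ∀ x, Ψ ((1 : Matrix ι ι k).mulVec x) = 1 * Ψ x := fun x => by
    rw [Matrix.one_mulVec, one_mul]
  have e1 := transpose_mul_gram_mul Ψ lam c hP h1
  have e2 := transpose_mul_gram_mul Ψ lam c h1 hP
  rw [Matrix.transpose_one, one_mul, one_mul] at e2
  rw [mul_one, mul_one] at e1
  rw [e1, e2]

/-- The condition makes `τ`, and hence every element of `R`, self-adjoint for `Q`. So `Q(a, b) =
Q(1, ab)` is a functional of `ab`, and by non-degeneracy and a dimension count every functional is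
`lam (c * ·)`. -/
theorem exists_eq_gram (hlam : ∀ a, (∀ b, lam (a * b) = 0) → a = 0)
    (hP : ∀ x, Ψ (P.mulVec x) = τ * Ψ x)
    (hτ : Algebra.adjoin k {τ} = ⊤) {Q : Matrix ι ι k} (hQ : P.transpose * Q = Q * P) :
    ∃ c, Q = gram Ψ lam c := by
  have : Module.Finite k R := Module.Finite.equiv Ψ
  let D : R →ₗ[k] Module.Dual k R := (LinearMap.mul k R).compr₂ lam
  have hD : Function.Injective D := by
    rw [← LinearMap.ker_eq_bot, LinearMap.ker_eq_bot']
    intro a ha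
    exact hlam a fun b => congrArg (fun φ : Module.Dual k R => φ b) ha
  have hDs : Function.Surjective D :=
    (LinearMap.injective_iff_surjective_of_finrank_eq_finrank
      (Subspace.dual_finrank_eq (K := k) (V := R)).symm).1 hD
  have key : ∀ r : R, ∀ a b, Ψ.symm (r * a) ⬝ᵥ Q.mulVec (Ψ.symm b) =
      Ψ.symm a ⬝ᵥ Q.mulVec (Ψ.symm (r * b)) := by
    intro r
    have hr : r ∈ Algebra.adjoin k {τ} := by rw [hτ]; trivial
    induction hr using Algebra.adjoin_induction with
    | mem r hr =>
      intro a b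
      obtain rfl : r = τ := hr
      have e : ∀ x, Ψ.symm (r * x) = P.mulVec (Ψ.symm x) := fun x => by
        rw [LinearEquiv.symm_apply_eq, hP, LinearEquiv.apply_symm_apply]
      rw [e, e, Matrix.mulVec_mulVec, ← hQ, ← Matrix.mulVec_mulVec, Matrix.dotProduct_mulVec _ P.transpose,
        Matrix.vecMul_transpose]
    | algebraMap c =>
      intro a b
      simp only [← Algebra.smul_def, map_smul, Matrix.mulVec_smul, smul_dotProduct, dotProduct_smul]
    | add r s _ _ hr hs =>
      intro a b
      rw [add_mul, add_mul, map_add, map_add, Matrix.mulVec_add, add_dotProduct, dotProduct_add, hr,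
        hs]
    | mul r s _ _ hr hs =>
      intro a b
      rw [mul_assoc, hr, hs, ← mul_assoc, mul_comm s r]
  obtain ⟨c, hc⟩ := hDs (Matrix.toBilin' Q (Ψ.symm 1) ∘ₗ Ψ.symm.toLinearMap)
  refine ⟨c, matrix_ext_dotProduct fun x y => ?_⟩
  rw [dotProduct_gram_mulVec]
  have h1 := congrArg (fun φ : Module.Dual k R => φ (Ψ x * Ψ y)) hc
  simp only [LinearMap.comp_apply, Matrix.toBilin'_apply', LinearEquiv.coe_coe] at h1
  change lam (c * (Ψ x * Ψ y)) = _ at h1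
  rw [h1, ← key, mul_one, LinearEquiv.symm_apply_apply, LinearEquiv.symm_apply_apply]

/-- The kernel of the Gram matrix is the annihilator of `c`, which is zero in a finite-dimensional
commutative algebra exactly when `c` is a unit. -/
theorem isUnit_gram_iff (hlam : ∀ a, (∀ b, lam (a * b) = 0) → a = 0) (c : R) :
    IsUnit (gram Ψ lam c) ↔ IsUnit c := by
  have : Module.Finite k R := Module.Finite.equiv Ψ
  rw [← Matrix.mulVec_injective_iff_isUnit]
  have hker : ∀ x, (gram Ψ lam c).mulVec x = 0 ↔ c * Ψ x = 0 := by
    intro x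
    constructor
    · intro h
      refine hlam _ fun b => ?_
      have := dotProduct_gram_mulVec Ψ lam c (Ψ.symm b) x
      rw [h, dotProduct_zero, LinearEquiv.apply_symm_apply] at this
      rw [this]
      congr 1
      ring
    · intro h
      rw [← dotProduct_eq_zero_iff]
      intro y
      rw [dotProduct_comm, dotProduct_gram_mulVec, mul_left_comm, h, mul_zero, map_zero]
  have hinj : Function.Injective (gram Ψ lam c).mulVec ↔ ∀ x, c * Ψ x = 0 → x = 0 := by
    have := (LinearMap.ker_eq_bot' (f := Matrix.toLin' (gram Ψ lam c)))
    rw [LinearMap.ker_eq_bot] at this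
    simp only [Matrix.toLin'_apply, hker] at this
    exact this
  rw [hinj]
  constructor
  · intro h
    have h1 : Function.Injective (LinearMap.mulLeft k c) := by
      rw [← LinearMap.ker_eq_bot, LinearMap.ker_eq_bot']
      intro a ha
      have := h (Ψ.symm a) (by rwa [LinearEquiv.apply_symm_apply])
      rwa [LinearEquiv.map_eq_zero_iff] at this
    obtain ⟨d, hd⟩ := LinearMap.injective_iff_surjective.1 h1 1
    exact IsUnit.of_mul_eq_one d hd
  · intro hc x hx
    rwa [hc.mul_right_eq_zero, LinearEquiv.map_eq_zero_iff] at hx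

end Gram

/-! ### Truncated power series, squares and even parts in characteristic two. -/

section TruncatedSeries

variable {K : Type*} [Field K]

/-- The ring `K[z] / (z ^ n)`, as a quotient of the ring of power series. -/
def TruncatedSeries (K : Type*) [Field K] (n : ℕ) : Type _ :=
  PowerSeries K ⧸ Ideal.span {(PowerSeries.X : PowerSeries K) ^ n}

instance (n : ℕ) : CommRing (TruncatedSeries K n) :=
  inferInstanceAs (CommRing (PowerSeries K ⧸ Ideal.span {(PowerSeries.X : PowerSeries K) ^ n}))

instance {k : Type*} [Field k] [Algebra k K] (n : ℕ) : Algebra k (TruncatedSeries K n) :=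
  inferInstanceAs (Algebra k (PowerSeries K ⧸ Ideal.span {(PowerSeries.X : PowerSeries K) ^ n}))

/-- The class of a power series modulo `z ^ n`. -/
def truncMk (n : ℕ) : PowerSeries K →+* TruncatedSeries K n :=
  Ideal.Quotient.mk (Ideal.span {(PowerSeries.X : PowerSeries K) ^ n})

/-- The class of a power series modulo `z ^ n`, as a homomorphism of algebras. -/
def truncMkAlgHom (k : Type*) [Field k] [Algebra k K] (n : ℕ) :
    PowerSeries K →ₐ[k] TruncatedSeries K n :=
  Ideal.Quotient.mkₐ k (Ideal.span {(PowerSeries.X : PowerSeries K) ^ n})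

theorem truncMk_surjective (n : ℕ) : Function.Surjective (truncMk (K := K) n) :=
  Ideal.Quotient.mk_surjective

theorem truncMk_eq_iff {n : ℕ} {a b : PowerSeries K} :
    truncMk n a = truncMk n b ↔ ∀ j < n, PowerSeries.coeff j a = PowerSeries.coeff j b := by
  refine Ideal.Quotient.eq.trans ?_
  rw [Ideal.mem_span_singleton, PowerSeries.X_pow_dvd_iff]
  simp only [map_sub, sub_eq_zero]

theorem isUnit_truncMk_iff {n : ℕ} (hn : 1 ≤ n) {a : PowerSeries K} :
    IsUnit (truncMk n a) ↔ PowerSeries.coeff 0 a ≠ 0 := by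
  constructor
  · rintro ⟨u, hu⟩ h
    obtain ⟨b, hb⟩ := truncMk_surjective n u.inv
    have h1 : truncMk n (a * b) = truncMk n 1 := by
      rw [map_mul, ← hu, hb, u.val_inv, map_one]
    have := truncMk_eq_iff.1 h1 0 hn
    rw [PowerSeries.coeff_zero_eq_constantCoeff_apply] at this h
    simp [h] at this
  · intro h
    refine IsUnit.map _ ?_
    rw [PowerSeries.isUnit_iff_constantCoeff, isUnit_iff_ne_zero]
    rwa [← PowerSeries.coeff_zero_eq_constantCoeff_apply]

/-- The ring is local: the constant terms of `w` and `w - 1` cannot both vanish, so one factor of `w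
(w - 1) = 0` is a unit. -/
theorem eq_zero_or_eq_one_of_mul_self {n : ℕ} (hn : 1 ≤ n) {w : TruncatedSeries K n}
    (hw : w * w = w) : w = 0 ∨ w = 1 := by
  obtain ⟨a, rfl⟩ := truncMk_surjective n w
  have h0 : (truncMk n a) * (truncMk n a - 1) = 0 := by rw [mul_sub, hw, mul_one, sub_self]
  by_cases ha : PowerSeries.coeff 0 a = 0
  · left
    have hu : IsUnit (truncMk n (a - 1)) := by
      rw [isUnit_truncMk_iff hn]
      simp_all
    rw [map_sub, map_one] at hu
    rwa [hu.mul_left_eq_zero] at h0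
  · right
    rwa [((isUnit_truncMk_iff hn).2 ha).mul_right_eq_zero, sub_eq_zero] at h0

variable [CharP K 2]

theorem coeff_sq_of_charTwo (v : PowerSeries K) (j : ℕ) :
    PowerSeries.coeff j (v ^ 2) = if Even j then PowerSeries.coeff (j / 2) v ^ 2 else 0 := by
  have : ExpChar K 2 := ExpChar.prime Nat.prime_two
  have : CharP (PowerSeries K) 2 :=
    charP_of_injective_ringHom (PowerSeries.C_injective (R := K)) 2
  -- The tail beyond degree `j` squares into degrees above `j`, so the claim reduces to polynomials,
  -- where squaring is Frobenius on coefficients followed by expansion.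
  conv_lhs => rw [PowerSeries.eq_X_pow_mul_shift_add_trunc (j + 1) v]
  rw [CharTwo.add_sq, mul_pow, ← pow_mul, map_add, PowerSeries.coeff_X_pow_mul', if_neg (by omega),
    zero_add, ← Polynomial.coe_pow, Polynomial.coeff_coe, ← Polynomial.map_frobenius_expand 2,
    Polynomial.coeff_map, Polynomial.coeff_expand two_pos]
  simp only [even_iff_two_dvd]
  split_ifs with h
  · rw [PowerSeries.coeff_trunc, if_pos (by omega), frobenius_def]
  · simp

/-- The even part of a power series in characteristic two. -/
def evenPart (c : PowerSeries K) : PowerSeries K := c + PowerSeries.X * PowerSeries.derivative K c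

theorem coeff_evenPart (c : PowerSeries K) (j : ℕ) :
    PowerSeries.coeff j (evenPart c) = if Even j then PowerSeries.coeff j c else 0 := by
  rw [evenPart, map_add]
  rcases j with _ | j
  · simp
  · rw [PowerSeries.coeff_succ_X_mul, PowerSeries.coeff_derivative]
    -- The series `z c'` has `i`-th coefficient `i cᵢ`, so `c + z c'` scales `cᵢ` by `1 + i`, which
    -- is `1` or `0` by parity.
    have : (1 + ((j : K) + 1)) = if Even (j + 1) then 1 else 0 := by
      rw [add_comm, add_assoc, CharTwo.add_self_eq_zero, add_zero]
      split_ifs with h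
      · have hj : Odd j := by
          rw [← Nat.not_even_iff_odd]; intro h'; exact (Nat.even_add_one.1 h) h'
        obtain ⟨i, rfl⟩ := hj
        push_cast
        rw [CharTwo.two_eq_zero]; simp
      · rw [Nat.even_add_one, not_not] at h
        obtain ⟨i, rfl⟩ := h
        push_cast
        exact CharTwo.add_self_eq_zero _
    rw [← mul_one_add, this]
    split_ifs <;> simp

/-- Squares have derivative zero, so `c ↦ c + z c'` is linear over them. -/
theorem evenPart_mul_sq (c u : PowerSeries K) : evenPart (c * u ^ 2) = evenPart c * u ^ 2 := by
  have : CharP (PowerSeries K) 2 :=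
    charP_of_injective_ringHom (PowerSeries.C_injective (R := K)) 2
  have h : PowerSeries.derivative K (u ^ 2) = 0 := by
    rw [Derivation.leibniz_pow, two_smul, CharTwo.add_self_eq_zero]
  rw [evenPart, evenPart, Derivation.leibniz, h, smul_zero, zero_add, smul_eq_mul]
  ring

/-- Over a perfect field an even series is a square `v²`, by taking square roots of coefficients.
With `v²` the even part of `c`, the unit is `v⁻¹`. -/
theorem exists_mul_sq_evenPart_eq_one [PerfectField K] {c : PowerSeries K}
    (hc : PowerSeries.coeff 0 c ≠ 0) :
    ∃ u : PowerSeries K, IsUnit u ∧ evenPart (c * u ^ 2) = 1 := by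
  have hsq : ∀ x : K, ∃ y, y ^ 2 = x := fun x => by
    have := PerfectField.toPerfectRing (K := K) 2
    exact surjective_frobenius K 2 x
  choose s hs using hsq
  have hv : (PowerSeries.mk fun i => s (PowerSeries.coeff (2 * i) c)) ^ 2 = evenPart c := by
    ext j
    rw [coeff_sq_of_charTwo, coeff_evenPart, PowerSeries.coeff_mk, hs]
    split_ifs with h
    · rw [Nat.mul_div_cancel' (even_iff_two_dvd.1 h)]
    · rfl
  set v := PowerSeries.mk fun i => s (PowerSeries.coeff (2 * i) c)
  have hu : IsUnit v := by
    rw [← isUnit_pow_iff two_ne_zero, hv, PowerSeries.isUnit_iff_constantCoeff, isUnit_iff_ne_zero,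
      ← PowerSeries.coeff_zero_eq_constantCoeff_apply, coeff_evenPart]
    simpa using hc
  obtain ⟨u, hu⟩ := hu
  refine ⟨u.inv, (u⁻¹).isUnit, ?_⟩
  rw [evenPart_mul_sq, ← hv, ← hu, ← mul_pow, u.val_inv, one_pow]

/-- Taking even parts in `b u² ≡ b'` gives `u² ≡ 1` modulo `z^n`. This is the uniqueness of the
normal form. -/
theorem truncMk_eq_of_evenPart_eq_one {n : ℕ} {b b' u : PowerSeries K} (hb : evenPart b = 1)
    (hb' : evenPart b' = 1) (h : truncMk n (b * u ^ 2) = truncMk n b') :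
    truncMk n b = truncMk n b' := by
  have h1 : truncMk n (u ^ 2) = 1 := by
    rw [← map_one (truncMk n), ← hb', ← one_mul (u ^ 2), ← hb, ← evenPart_mul_sq, truncMk_eq_iff]
    intro j hj
    rw [coeff_evenPart, coeff_evenPart, truncMk_eq_iff.1 h j hj]
  rw [← h, map_mul, h1, mul_one]

/-- Squares have only even-degree coefficients. Conversely `u = y z^i` isolates coefficient `n - 1 -
2i` of `c` multiplied by `y²`, and `y²` runs over all of `K`. -/
theorem forall_trace_coeff_mul_sq_iff {k : Type*} [Field k] [Algebra k K] [PerfectField K]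
    (tr : K →ₗ[k] k) (htr : ∀ a, (∀ x, tr (a * x) = 0) → a = 0) (n : ℕ) (c : PowerSeries K) :
    (∀ u : PowerSeries K, tr (PowerSeries.coeff (n - 1) (c * u ^ 2)) = 0) ↔
      ∀ j ≤ n - 1, Even (n - 1 - j) → PowerSeries.coeff j c = 0 := by
  constructor
  · intro h j hj he
    refine htr _ fun x => ?_
    obtain ⟨y, rfl⟩ : ∃ y, y ^ 2 = x := by
      have := PerfectField.toPerfectRing (K := K) 2
      exact surjective_frobenius K 2 x
    obtain ⟨i, hi⟩ := he
    have := h (PowerSeries.C y * PowerSeries.X ^ i)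
    have e : c * (PowerSeries.C y * PowerSeries.X ^ i) ^ 2 =
        PowerSeries.X ^ (i + i) * (PowerSeries.C (y ^ 2) * c) := by
      rw [map_pow]; ring
    rw [e, PowerSeries.coeff_X_pow_mul', if_pos (by omega), PowerSeries.coeff_C_mul] at this
    rw [← this, mul_comm]
    congr 4
    omega
  · intro h u
    rw [PowerSeries.coeff_mul, Finset.sum_eq_zero, map_zero]
    rintro ⟨a, b⟩ hab
    rw [Finset.HasAntidiagonal.mem_antidiagonal] at hab
    simp only at hab ⊢
    rw [coeff_sq_of_charTwo]
    split_ifs with hb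
    · rw [h a (by omega) (by rwa [show n - 1 - a = b by omega]), zero_mul]
    · rw [mul_zero]

end TruncatedSeries

/-! ### Non-degeneracy of the trace of the top coefficient. -/

section TruncatedDuality

variable {k K : Type*} [Field k] [Field K] [Algebra k K]

/-- The truncated power series with given first `n` coefficients. -/
def truncOfCoeff (k K : Type*) [Field k] [Field K] [Algebra k K] (n : ℕ) :
    (Fin n → K) →ₗ[k] TruncatedSeries K n :=
  (truncMkAlgHom k n).toLinearMap ∘ₗ
    { toFun := fun a : Fin n → K =>
        (PowerSeries.mk fun j => if h : j < n then a ⟨j, h⟩ else 0 : PowerSeries K)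
      map_add' := fun a b => by
        ext j
        by_cases hj : j < n <;> simp [hj]
      map_smul' := fun r a => by
        ext j
        by_cases hj : j < n <;> simp [hj] }

theorem truncOfCoeff_apply (n : ℕ) (a : Fin n → K) :
    truncOfCoeff k K n a =
      truncMk n (PowerSeries.mk fun j => if h : j < n then a ⟨j, h⟩ else 0) := rfl

theorem truncOfCoeff_coeff (n : ℕ) (g : PowerSeries K) :
    truncOfCoeff k K n (fun j => PowerSeries.coeff j g) = truncMk n g := by
  rw [truncOfCoeff_apply, truncMk_eq_iff]
  intro j hj
  simp [hj]

theorem truncOfCoeff_bijective (n : ℕ) : Function.Bijective (truncOfCoeff k K n) := by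
  constructor
  · intro a b h
    rw [truncOfCoeff_apply, truncOfCoeff_apply] at h
    have := truncMk_eq_iff.1 h
    ext j
    simpa using this j j.2
  · intro r
    obtain ⟨g, rfl⟩ := truncMk_surjective n r
    exact ⟨_, truncOfCoeff_coeff n g⟩

/-- Truncated power series are determined by their first `n` coefficients. -/
def truncCoeffEquiv (k K : Type*) [Field k] [Field K] [Algebra k K] (n : ℕ) :
    (Fin n → K) ≃ₗ[k] TruncatedSeries K n :=
  LinearEquiv.ofBijective (truncOfCoeff k K n) (truncOfCoeff_bijective n)

theorem truncCoeffEquiv_symm_truncMk (n : ℕ) (g : PowerSeries K) (j : Fin n) :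
    (truncCoeffEquiv k K n).symm (truncMk n g) j = PowerSeries.coeff j g := by
  have : (truncCoeffEquiv k K n).symm (truncMk n g) = fun j : Fin n => PowerSeries.coeff j g := by
    rw [LinearEquiv.symm_apply_eq]
    exact (truncOfCoeff_coeff n g).symm
  rw [this]

/-- The trace of the coefficient of `z ^ (n - 1)`. -/
def traceTop (k K : Type*) [Field k] [Field K] [Algebra k K] {n : ℕ} (hn : 1 ≤ n) :
    TruncatedSeries K n →ₗ[k] k :=
  Algebra.trace k K ∘ₗ LinearMap.proj ⟨n - 1, by omega⟩ ∘ₗ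
    (truncCoeffEquiv k K n).symm.toLinearMap

theorem traceTop_truncMk {n : ℕ} (hn : 1 ≤ n) (g : PowerSeries K) :
    traceTop k K hn (truncMk n g) = Algebra.trace k K (PowerSeries.coeff (n - 1) g) := by
  simp [traceTop, truncCoeffEquiv_symm_truncMk]

variable [FiniteDimensional k K] [Algebra.IsSeparable k K]

theorem eq_zero_of_forall_trace_mul {a : K} (h : ∀ x, Algebra.trace k K (a * x) = 0) : a = 0 :=
  (traceForm_nondegenerate k K).1 a h

/-- Testing against `x z^(n-1-j)` moves coefficient `j` to the top, where the trace form of the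
separable extension detects it. -/
theorem eq_zero_of_forall_traceTop_mul {n : ℕ} (hn : 1 ≤ n) (a : TruncatedSeries K n)
    (h : ∀ b, traceTop k K hn (a * b) = 0) : a = 0 := by
  obtain ⟨a, rfl⟩ := truncMk_surjective n a
  rw [← map_zero (truncMk n), truncMk_eq_iff]
  intro j hj
  rw [map_zero]
  refine eq_zero_of_forall_trace_mul (k := k) fun x => ?_
  have := h (truncMk n (PowerSeries.X ^ (n - 1 - j) * PowerSeries.C x))
  rw [← map_mul, traceTop_truncMk, mul_left_comm, PowerSeries.coeff_X_pow_mul',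
    if_pos (by omega), PowerSeries.coeff_mul_C] at this
  rw [← this]
  congr 4
  omega

end TruncatedDuality

/-! ### The companion matrix as multiplication by `ε + z`. -/

section Companion

variable {k : Type*} [Field k] (f : k[X]) [Fact (Irreducible f)]

/-- The power series `ε + z`. -/
def rootAddX : PowerSeries (AdjoinRoot f) :=
  PowerSeries.C (AdjoinRoot.root f) + PowerSeries.X

theorem constantCoeff_aeval_rootAddX (p : k[X]) :
    PowerSeries.constantCoeff (aeval (rootAddX f) p) = AdjoinRoot.mk f p := by
  rw [← AdjoinRoot.aeval_eq, aeval_def, aeval_def, Polynomial.hom_eval₂]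
  congr 1
  simp [rootAddX]

theorem derivative_aeval_rootAddX (p : k[X]) :
    PowerSeries.derivative (AdjoinRoot f) (aeval (rootAddX f) p) =
      aeval (rootAddX f) (derivative p) := by
  have h := ((PowerSeries.derivative (AdjoinRoot f)).restrictScalars k).map_aeval p (rootAddX f)
  have h1 : PowerSeries.derivative (AdjoinRoot f) (rootAddX f) = 1 := by
    simp [rootAddX]
  simp only [Derivation.coe_restrictScalars, h1, smul_eq_mul, mul_one] at h
  exact h

/-- Since `f(ε) = 0`, `z` divides `f(ε + z)`; the cofactor has constant term `f'(ε)`, non-zero by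
separability. -/
theorem exists_aeval_rootAddX_eq_X_mul [PerfectField k] :
    ∃ v : PowerSeries (AdjoinRoot f), IsUnit v ∧ aeval (rootAddX f) f = PowerSeries.X * v := by
  obtain ⟨v, hv⟩ : PowerSeries.X ∣ aeval (rootAddX f) f := by
    rw [PowerSeries.X_dvd_iff, constantCoeff_aeval_rootAddX, AdjoinRoot.mk_self]
  refine ⟨v, ?_, hv⟩
  have h := constantCoeff_aeval_rootAddX f (derivative f)
  rw [← derivative_aeval_rootAddX, hv, Derivation.leibniz] at h
  simp only [smul_eq_mul, map_add, map_mul, PowerSeries.constantCoeff_X, zero_mul, zero_add,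
    PowerSeries.derivative_X, mul_one] at h
  rw [PowerSeries.isUnit_iff_constantCoeff, isUnit_iff_ne_zero, h, Ne, AdjoinRoot.mk_eq_zero]
  have hirr : Irreducible f := Fact.out
  have hsep : IsCoprime f (derivative f) := PerfectField.separable_of_irreducible hirr
  exact fun hd => hirr.not_isUnit (hsep.isUnit_of_dvd' dvd_rfl hd)

/-- If `p = f^a q` with `f ∤ q`, then `p(ε + z)` is `z^a` times a unit. Thus `T ↦ ε + z` has kernel
`(f^n)` modulo `z^n`. -/
theorem X_pow_dvd_aeval_rootAddX_iff [PerfectField k] (n : ℕ) (p : k[X]) :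
    PowerSeries.X ^ n ∣ aeval (rootAddX f) p ↔ f ^ n ∣ p := by
  obtain ⟨v, hv, hf⟩ := exists_aeval_rootAddX_eq_X_mul f
  have hirr : Irreducible f := Fact.out
  constructor
  · intro h
    by_cases hp : p = 0
    · rw [hp]; exact dvd_zero _
    obtain ⟨q, hq, hnd⟩ :=
      (FiniteMultiplicity.of_not_isUnit hirr.not_isUnit hp).exists_eq_pow_mul_and_not_dvd
    set a := multiplicity f p
    have hu : IsUnit (aeval (rootAddX f) q) := by
      rw [PowerSeries.isUnit_iff_constantCoeff, isUnit_iff_ne_zero, constantCoeff_aeval_rootAddX,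
        Ne, AdjoinRoot.mk_eq_zero]
      exact hnd
    rw [hq, map_mul, map_pow, hf, mul_pow, hu.dvd_mul_right, (hv.pow a).dvd_mul_right,
      pow_dvd_pow_iff PowerSeries.X_ne_zero PowerSeries.X_prime.not_isUnit] at h
    rw [hq]
    exact (pow_dvd_pow f h).mul_right q
  · intro h
    obtain ⟨q, rfl⟩ := h
    rw [map_mul, map_pow, hf, mul_pow, mul_assoc]
    exact dvd_mul_right _ _

/-- The image of `T` in `K[z] / (z ^ n)`. -/
def truncRoot (n : ℕ) : TruncatedSeries (AdjoinRoot f) n := truncMk n (rootAddX f)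

theorem aeval_truncRoot (n : ℕ) (p : k[X]) :
    aeval (truncRoot f n) p = truncMk n (aeval (rootAddX f) p) :=
  aeval_algHom_apply (truncMkAlgHom k n) (rootAddX f) p

theorem aeval_truncRoot_eq_zero_iff [PerfectField k] (n : ℕ) (p : k[X]) :
    aeval (truncRoot f n) p = 0 ↔ f ^ n ∣ p := by
  rw [aeval_truncRoot, ← X_pow_dvd_aeval_rootAddX_iff, ← Ideal.mem_span_singleton]
  exact Ideal.Quotient.eq_zero_iff_mem

/-- The linear map that sends the `i`-th unit vector to the `i`-th power of `truncRoot f n`. -/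
def powersMap (n : ℕ) : (Idx f n → k) →ₗ[k] TruncatedSeries (AdjoinRoot f) n :=
  Fintype.linearCombination k fun i => truncRoot f n ^ i.val

theorem powersMap_apply (n : ℕ) (x : Idx f n → k) :
    powersMap f n x = aeval (truncRoot f n) (∑ i, C (x i) * X ^ i.val) := by
  simp only [powersMap, Fintype.linearCombination_apply, map_sum, map_mul, map_pow, aeval_C, aeval_X]
  exact Finset.sum_congr rfl fun i _ => Algebra.smul_def _ _

theorem powersMap_single (n : ℕ) (i : Idx f n) :
    powersMap f n (Pi.single i 1) = truncRoot f n ^ i.val := by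
  simp [powersMap, Fintype.linearCombination_apply_single]

theorem powersMap_injective [PerfectField k] (hf : f.Monic) (n : ℕ) :
    Function.Injective (powersMap f n) := by
  rw [← LinearMap.ker_eq_bot, LinearMap.ker_eq_bot']
  intro x hx
  rw [powersMap_apply, aeval_truncRoot_eq_zero_iff] at hx
  have hdeg : (∑ i, C (x i) * X ^ i.val).degree < (f ^ n).degree := by
    have hN : (f ^ n).natDegree = f.natDegree * n := by rw [hf.natDegree_pow, mul_comm]
    rw [degree_eq_natDegree (hf.pow n).ne_zero, hN]
    refine (degree_sum_le _ _).trans_lt ?_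
    rw [Finset.sup_lt_iff (WithBot.bot_lt_coe _)]
    intro i _
    refine (degree_C_mul_X_pow_le _ _).trans_lt ?_
    exact_mod_cast i.2
  have h0 := eq_zero_of_dvd_of_degree_lt hx hdeg
  ext i
  have := congrArg (fun p => coeff p i.val) h0
  simpa [finsetSum_coeff, coeff_X_pow, Fin.val_inj, Finset.sum_ite_eq] using this

theorem finrank_truncatedSeries (n : ℕ) :
    Module.finrank k (Idx f n → k) = Module.finrank k (TruncatedSeries (AdjoinRoot f) n) := by
  have hf0 : f ≠ 0 := (Fact.out : Irreducible f).ne_zero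
  have : FiniteDimensional k (AdjoinRoot f) := (AdjoinRoot.powerBasis hf0).finite
  rw [← (truncCoeffEquiv k (AdjoinRoot f) n).finrank_eq, Module.finrank_fintype_fun_eq_card,
    Fintype.card_fin, Module.finrank_pi_fintype]
  simp [(AdjoinRoot.powerBasis hf0).finrank, mul_comm]

/-- The identification of `k ^ (mn)` with `K[z] / (z ^ n)`. -/
def powersEquiv [PerfectField k] (hf : f.Monic) (n : ℕ) :
    (Idx f n → k) ≃ₗ[k] TruncatedSeries (AdjoinRoot f) n :=
  have hf0 : f ≠ 0 := (Fact.out : Irreducible f).ne_zero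
  have : FiniteDimensional k (AdjoinRoot f) := (AdjoinRoot.powerBasis hf0).finite
  have : FiniteDimensional k (TruncatedSeries (AdjoinRoot f) n) :=
    Module.Finite.equiv (truncCoeffEquiv k (AdjoinRoot f) n)
  LinearMap.linearEquivOfInjective (powersMap f n) (powersMap_injective f hf n)
    (finrank_truncatedSeries f n)

theorem powersEquiv_apply [PerfectField k] (hf : f.Monic) (n : ℕ) (x : Idx f n → k) :
    powersEquiv f hf n x = powersMap f n x := rfl

theorem adjoin_truncRoot [PerfectField k] (hf : f.Monic) (n : ℕ) :
    Algebra.adjoin k {truncRoot f n} = ⊤ := by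
  rw [eq_top_iff]
  intro r _
  rw [← (powersEquiv f hf n).apply_symm_apply r, powersEquiv_apply, powersMap_apply]
  exact aeval_mem_adjoin_singleton k _

theorem powersEquiv_companionPow_mulVec [CharP k 2] [PerfectField k] (hf : f.Monic) (n : ℕ)
    (x : Idx f n → k) :
    powersEquiv f hf n ((companionPow f n).mulVec x) = truncRoot f n * powersEquiv f hf n x := by
  suffices h : (powersEquiv f hf n).toLinearMap ∘ₗ Matrix.toLin' (companionPow f n) =
      LinearMap.mulLeft k (truncRoot f n) ∘ₗ (powersEquiv f hf n).toLinearMap from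
    congrArg (fun φ : (Idx f n → k) →ₗ[k] TruncatedSeries (AdjoinRoot f) n => φ x) h
  refine (Pi.basisFun k (Idx f n)).ext fun j => ?_
  simp only [Pi.basisFun_apply, LinearMap.comp_apply, LinearEquiv.coe_coe, Matrix.toLin'_apply,
    Matrix.mulVec_single_one, LinearMap.mulLeft_apply, powersEquiv_apply, powersMap_single]
  rw [← pow_succ']
  by_cases hj : j.val + 1 = f.natDegree * n
  -- The last column encodes the relation `f^n(τ) = 0` solved for `τ^(mn)`; no sign appears in
  -- characteristic two.
  · have h0 : aeval (truncRoot f n) (f ^ n) = 0 := (aeval_truncRoot_eq_zero_iff f n _).2 dvd_rfl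
    have hN : (f ^ n).natDegree = f.natDegree * n := by rw [hf.natDegree_pow, mul_comm]
    rw [aeval_eq_sum_range, Finset.sum_range_succ, (hf.pow n).coeff_natDegree, one_smul, hN] at h0
    have hneg : ∀ a b : TruncatedSeries (AdjoinRoot f) n, a + b = 0 → a = b := by
      intro a b h
      have h2 : b + b = 0 := by
        rw [← two_smul k b, CharTwo.two_eq_zero, zero_smul]
      calc a = a + (b + b) := by rw [h2, add_zero]
        _ = b := by rw [← add_assoc, h, zero_add]
    rw [hj, ← hneg _ _ h0, Finset.sum_range]
    rw [powersMap, Fintype.linearCombination_apply]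
    refine Finset.sum_congr rfl fun i _ => ?_
    simp [companionPow, hj]
  · have hj' : j.val + 1 < f.natDegree * n := by have := j.2; omega
    rw [show truncRoot f n ^ (j.val + 1) = truncRoot f n ^ (⟨j.val + 1, hj'⟩ : Idx f n).val from rfl,
      ← powersMap_single]
    congr 1
    ext i
    simp [companionPow, hj, Pi.single_apply, Fin.ext_iff]

end Companion

/-! ### Hankel matrices as power series. -/

section HankelSeries

variable {K : Type*} [Field K]

/-- The power series `1 + ∑ a_i z ^ (i - 1)`, the sum over the even `i` with `2 ≤ i ≤ n`. -/
def hankelSeries (n : ℕ) (a : ℕ → K) : PowerSeries K :=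
  PowerSeries.mk fun j => if j = 0 then 1 else if Odd j ∧ j < n then a (j + 1) else 0

/-- Entries depend only on the antidiagonal: the one `s + t = n + i`, counted from `1`, carries the
coefficient of `z^(i-1)`. -/
theorem hankelOf_apply (n : ℕ) (a : ℕ → K) (p q : Fin n) :
    hankelOf n a p q = if n ≤ p.val + q.val + 1 then
      PowerSeries.coeff (p.val + q.val + 1 - n) (hankelSeries n a) else 0 := by
  have hp := p.2
  have hq := q.2
  simp only [hankelOf, hankelUnit, Matrix.add_apply, Matrix.sum_apply, Matrix.of_apply,
    hankelSeries, PowerSeries.coeff_mk]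
  rcases lt_trichotomy (p.val + q.val + 1) n with h | h | h
  · rw [if_neg (by omega), if_neg (by omega), zero_add]
    refine Finset.sum_eq_zero fun i hi => if_neg ?_
    rw [Finset.mem_filter, Finset.mem_Icc] at hi
    omega
  · rw [if_pos (by omega), if_pos (by omega), if_pos (by omega), Finset.sum_eq_zero, add_zero]
    intro i hi
    rw [Finset.mem_filter, Finset.mem_Icc] at hi
    exact if_neg (by omega)
  · rw [if_neg (by omega), if_pos (by omega), if_neg (by omega), zero_add]
    have e : ∀ i, (p.val + 1 + (q.val + 1) = n + i) = (p.val + q.val + 1 - n + 1 = i) := fun i =>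
      propext (by omega)
    simp only [e, Finset.sum_ite_eq, Finset.mem_filter, Finset.mem_Icc]
    refine if_congr ?_ rfl rfl
    rw [Nat.even_add_one, Nat.not_even_iff_odd]
    constructor
    · rintro ⟨-, ho⟩
      exact ⟨ho, by omega⟩
    · rintro ⟨ho, -⟩
      exact ⟨⟨by omega, by omega⟩, ho⟩

theorem evenPart_hankelSeries [CharP K 2] (n : ℕ) (a : ℕ → K) :
    evenPart (hankelSeries n a) = 1 := by
  ext j
  rw [coeff_evenPart, hankelSeries, PowerSeries.coeff_mk, PowerSeries.coeff_one]
  by_cases h0 : j = 0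
  · simp [h0]
  · by_cases hj : Even j
    · simp [h0, hj, Nat.not_odd_iff_even.2 hj]
    · simp [h0, hj]

theorem exists_hankelSeries_eq [CharP K 2] (n : ℕ) {b : PowerSeries K} (hb : evenPart b = 1) :
    ∃ a, truncMk n (hankelSeries n a) = truncMk n b := by
  refine ⟨fun i => PowerSeries.coeff (i - 1) b, truncMk_eq_iff.2 fun j hj => ?_⟩
  have h := congrArg (PowerSeries.coeff j) hb
  rw [coeff_evenPart, PowerSeries.coeff_one] at h
  rw [hankelSeries, PowerSeries.coeff_mk]
  by_cases h0 : j = 0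
  · subst h0; simpa using h.symm
  · by_cases hje : Even j
    · rw [if_pos hje, if_neg h0] at h
      simp [h0, Nat.not_odd_iff_even.2 hje, h]
    · simp [h0, Nat.not_even_iff_odd.1 hje, hj]

theorem hankelOf_eq_iff {n : ℕ} {a a' : ℕ → K} :
    hankelOf n a = hankelOf n a' ↔
      truncMk n (hankelSeries n a) = truncMk n (hankelSeries n a') := by
  rw [truncMk_eq_iff]
  constructor
  · intro h j hj
    -- The last row of the matrix lists all `n` coefficients.
    have := congrFun (congrFun h ⟨n - 1, by omega⟩) ⟨j, hj⟩
    rw [hankelOf_apply, hankelOf_apply] at this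
    simp only at this
    rwa [if_pos (by omega), if_pos (by omega), show n - 1 + j + 1 - n = j by omega] at this
  · intro h
    ext p q
    rw [hankelOf_apply, hankelOf_apply]
    have hp := p.2
    have hq := q.2
    split_ifs with h1
    · exact h _ (by omega)
    · rfl

theorem hankelOf_eq_iff_forall {n : ℕ} {a a' : ℕ → K} :
    hankelOf n a = hankelOf n a' ↔ ∀ j, Odd j → j < n → a (j + 1) = a' (j + 1) := by
  rw [hankelOf_eq_iff, truncMk_eq_iff]
  constructor
  · intro h j hj hjn
    have := h j hjn
    have h0 : j ≠ 0 := by rintro rfl; simp at hj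
    simpa [hankelSeries, h0, hj, hjn] using this
  · intro h j hjn
    simp only [hankelSeries, PowerSeries.coeff_mk]
    split_ifs with h0 h1
    · rfl
    · exact h j h1.1 h1.2
    · rfl

theorem natCard_hankelSet (n : ℕ) : (hankelSet K n).ncard = Nat.card K ^ (n / 2) := by
  -- The free parameters are `a_2, a_4, …`, with `c i` in the place of `a_(2i+2)`.
  let φ : (Fin (n / 2) → K) → Matrix (Fin n) (Fin n) K := fun c =>
    hankelOf n fun i => if h : i / 2 - 1 < n / 2 then c ⟨i / 2 - 1, h⟩ else 0
  have hinj : Function.Injective φ := by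
    intro c c' h
    ext ⟨i, hi⟩
    have := hankelOf_eq_iff_forall.1 h (2 * i + 1) ⟨i, rfl⟩ (by omega)
    have e : (2 * i + 1 + 1) / 2 - 1 = i := by omega
    simpa only [e, hi, dif_pos] using this
  have hrange : hankelSet K n = Set.range φ := by
    refine Set.Subset.antisymm ?_ ?_
    · rintro _ ⟨a, rfl⟩
      refine ⟨fun i => a (2 * i.val + 2), hankelOf_eq_iff_forall.2 ?_⟩
      rintro j ⟨i, rfl⟩ hj
      have e : (2 * i + 1 + 1) / 2 - 1 = i := by omega
      have hi : i < n / 2 := by omega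
      simp only [e, hi, dif_pos]
    · rintro _ ⟨c, rfl⟩
      exact ⟨_, rfl⟩
  rw [hrange, ← Nat.card_coe_set_eq, Nat.card_range_of_injective hinj, Nat.card_fun]
  simp

theorem coeff_mul_mul (N : ℕ) (b g h : PowerSeries K) :
    PowerSeries.coeff N (b * (g * h)) = ∑ P ∈ Finset.range (N + 1), ∑ Q ∈ Finset.range (N + 1),
      if P + Q ≤ N then PowerSeries.coeff P g * PowerSeries.coeff (N - P - Q) b *
        PowerSeries.coeff Q h else 0 := by
  rw [show b * (g * h) = g * (h * b) by ring, PowerSeries.coeff_mul,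
    Finset.Nat.sum_antidiagonal_eq_sum_range_succ
      fun i j => PowerSeries.coeff i g * PowerSeries.coeff j (h * b)]
  refine Finset.sum_congr rfl fun P hP => ?_
  rw [Finset.mem_range] at hP
  rw [PowerSeries.coeff_mul, Finset.Nat.sum_antidiagonal_eq_sum_range_succ
      fun i j => PowerSeries.coeff i h * PowerSeries.coeff j b, Finset.mul_sum, ← Finset.sum_filter]
  refine Finset.sum_congr ?_ fun Q _ => by ring
  ext Q
  simp only [Finset.mem_range, Finset.mem_filter]
  omega

/-- With coefficients listed from the top degree down, the Hankel matrix is the Gram matrix of `(g,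
h) ↦` coefficient `n - 1` of `b g h`. -/
theorem sum_sum_hankelOf (n : ℕ) (hn : 1 ≤ n) (a : ℕ → K) (g h : PowerSeries K) :
    ∑ p : Fin n, ∑ q : Fin n, PowerSeries.coeff (n - 1 - p) g * hankelOf n a p q *
      PowerSeries.coeff (n - 1 - q) h =
      PowerSeries.coeff (n - 1) (hankelSeries n a * (g * h)) := by
  rw [coeff_mul_mul, Nat.sub_add_cancel hn, ← Finset.sum_range_reflect, Finset.sum_range]
  refine Finset.sum_congr rfl fun p _ => ?_
  rw [← Finset.sum_range_reflect, Finset.sum_range]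
  refine Finset.sum_congr rfl fun q _ => ?_
  have hp := p.2
  have hq := q.2
  rw [hankelOf_apply]
  by_cases hpq : n ≤ p.val + q.val + 1
  · rw [if_pos hpq, if_pos (by omega)]
    rw [show n - 1 - (n - 1 - p.val) - (n - 1 - q.val) = p.val + q.val + 1 - n by omega]
  · rw [if_neg hpq, if_neg (by omega), mul_zero, zero_mul]

end HankelSeries

/-! ### Descent of `𝒱(X)` from `E` to `k`. -/

section Descent

theorem rootHom_root {k E : Type*} [Field k] [Field E] [Algebra k E] (f : k[X])
    (x : E) (hx : aeval x f = 0) :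
    rootHom f x hx (AdjoinRoot.root f) = x :=
  AdjoinRoot.liftAlgHom_root _ _ _ _

variable {k : Type*} [Field k] (f : k[X]) [Fact (Irreducible f)]

/-- The matrix over `k` that becomes `scriptV` over the field containing the roots of `f`. -/
def traceMatrix (n : ℕ) (A : Matrix (Fin n) (Fin n) (AdjoinRoot f)) :
    Matrix (Idx f n) (Idx f n) k :=
  Matrix.of fun i j => Algebra.trace k (AdjoinRoot f)
    (∑ p : Fin n, ∑ q : Fin n, PowerSeries.coeff (n - 1 - p) (rootAddX f ^ i.val) * A p q *
      PowerSeries.coeff (n - 1 - q) (rootAddX f ^ j.val))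

theorem traceMatrix_hankelOf [PerfectField k] (hf : f.Monic) (n : ℕ) (hn : 1 ≤ n)
    (a : ℕ → AdjoinRoot f) :
    traceMatrix f n (hankelOf n a) = gram (powersEquiv f hf n) (traceTop k (AdjoinRoot f) hn)
      (truncMk n (hankelSeries n a)) := by
  ext i j
  simp only [traceMatrix, Matrix.of_apply, gram]
  rw [sum_sum_hankelOf n hn, powersEquiv_apply, powersEquiv_apply, powersMap_single,
    powersMap_single, truncRoot, ← map_pow, ← map_pow, ← map_mul, ← map_mul, traceTop_truncMk]

variable {E : Type*} [Field E] [Algebra k E]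

/-- On coefficients listed from degree `n - 1` down to `0`, multiplication by `ε + z` is the Jordan
block, and `e_n` is the series `1`. The columns of `V` are therefore the conjugates of the powers of
`ε + z`. -/
theorem changeOfBasis_apply (n : ℕ) (e : Fin f.natDegree → E) (he : ∀ t, aeval (e t) f = 0)
    (p : Fin n) (t : Fin f.natDegree) (i : Fin (f.natDegree * n)) :
    changeOfBasis n e (p, t) i =
      rootHom f (e t) (he t) (PowerSeries.coeff (n - 1 - p) (rootAddX f ^ i.val)) := by
  have key : ∀ (i : ℕ) (p : Fin n), ((jordanMatrix n e ^ i).mulVec (firstColumn f.natDegree n)) (p, t) =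
      rootHom f (e t) (he t) (PowerSeries.coeff (n - 1 - p) (rootAddX f ^ i)) := by
    intro i
    induction i with
    | zero =>
      intro p
      have := p.2
      rw [pow_zero, Matrix.one_mulVec, firstColumn, pow_zero, PowerSeries.coeff_one]
      by_cases h : p.val + 1 = n
      · rw [if_pos h, if_pos (by omega), map_one]
      · rw [if_neg h, if_neg (by omega), map_zero]
    | succ i ih =>
      intro p
      have hp := p.2
      rw [pow_succ', ← Matrix.mulVec_mulVec, pow_succ']
      have hmul : ∀ g : PowerSeries (AdjoinRoot f), rootAddX f * g =
        PowerSeries.C (AdjoinRoot.root f) * g + PowerSeries.X * g := fun g => add_mul _ _ _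
      rw [hmul, map_add, PowerSeries.coeff_C_mul, map_add, map_mul]
      have hmat : ∀ s : Fin n × Fin f.natDegree, jordanMatrix n e (p, t) s =
          if t = s.2 then jordanBlock n (e t) p s.1 else 0 := fun s =>
        Matrix.blockDiagonal_apply _ _ _
      rw [rootHom_root, Matrix.mulVec, dotProduct, Fintype.sum_prod_type]
      simp only [hmat, ite_mul, zero_mul, Finset.sum_ite_eq,
        Finset.mem_univ, if_true, ih]
      have hJ : ∀ q, jordanBlock n (e t) p q = (if p = q then e t else 0) +
          if p.val + 1 = q.val then 1 else 0 := by
        intro q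
        simp only [jordanBlock, Matrix.of_apply]
        by_cases h : p = q
        · subst h; simp
        · simp [h]
      simp only [hJ, add_mul, Finset.sum_add_distrib, ite_mul, zero_mul, Finset.sum_ite_eq,
        Finset.mem_univ, if_true, one_mul]
      congr 1
      by_cases h : p.val + 1 < n
      · rw [Finset.sum_eq_single ⟨p.val + 1, h⟩]
        · rw [if_pos rfl, show n - 1 - p.val = (n - 1 - (p.val + 1)) + 1 by omega,
            PowerSeries.coeff_succ_X_mul]
        · intro q _ hq
          refine if_neg fun h' => hq ?_
          ext
          exact h'.symm
        · simp
      · rw [show n - 1 - p.val = 0 by omega, PowerSeries.coeff_zero_X_mul, map_zero]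
        exact Finset.sum_eq_zero fun q _ => if_neg (by have := q.2; omega)
  exact key i p

/-- The `m` distinct roots yield `m` distinct embeddings of `K` into an algebraic closure of `E`,
and there are only `m` of them, so the sum is the trace. -/
theorem algebraMap_trace_eq_sum [PerfectField k] (e : Fin f.natDegree → E)
    (hinj : Function.Injective e) (he : ∀ t, aeval (e t) f = 0) (x : AdjoinRoot f) :
    algebraMap k E (Algebra.trace k (AdjoinRoot f) x) = ∑ t, rootHom f (e t) (he t) x := by
  have hf0 : f ≠ 0 := (Fact.out : Irreducible f).ne_zero
  have : FiniteDimensional k (AdjoinRoot f) := (AdjoinRoot.powerBasis hf0).finite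
  let L := AlgebraicClosure E
  apply (algebraMap E L).injective
  rw [← IsScalarTower.algebraMap_apply, trace_eq_sum_embeddings L, map_sum]
  let φ : Fin f.natDegree → (AdjoinRoot f →ₐ[k] L) := fun t =>
    (IsScalarTower.toAlgHom k E L).comp (rootHom f (e t) (he t))
  have hφ : Function.Injective φ := by
    intro t t' h
    have := congrArg (fun ψ : AdjoinRoot f →ₐ[k] L => ψ (AdjoinRoot.root f)) h
    have hroot : ∀ t, φ t (AdjoinRoot.root f) = algebraMap E L (e t) := by
      intro t
      exact congrArg (algebraMap E L) (rootHom_root f (e t) (he t))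
    simp only [hroot] at this
    exact hinj ((algebraMap E L).injective this)
  have hcard : Fintype.card (Fin f.natDegree) = Fintype.card (AdjoinRoot f →ₐ[k] L) := by
    rw [AlgHom.card, (AdjoinRoot.powerBasis hf0).finrank, AdjoinRoot.powerBasis_dim,
      Fintype.card_fin]
  exact (Function.Bijective.sum_comp ((Fintype.bijective_iff_injective_and_card φ).2 ⟨hφ, hcard⟩)
    fun ψ : AdjoinRoot f →ₐ[k] L => ψ x).symm

theorem traceMatrix_map [PerfectField k] (n : ℕ) (e : Fin f.natDegree → E)
    (hinj : Function.Injective e) (he : ∀ t, aeval (e t) f = 0)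
    (A : Matrix (Fin n) (Fin n) (AdjoinRoot f)) :
    (traceMatrix f n A).map (algebraMap k E) = scriptV f n e he A := by
  ext i j
  rw [Matrix.map_apply, traceMatrix, Matrix.of_apply, algebraMap_trace_eq_sum f e hinj he]
  simp only [scriptV, Matrix.mul_apply, Matrix.transpose_apply, Fintype.sum_prod_type,
    Matrix.blockDiagonal_apply, changeOfBasis_apply f n e he, map_sum, map_mul, Matrix.map_apply,
    mul_ite, mul_zero, Finset.sum_ite_eq', Finset.mem_univ, if_true, Finset.sum_mul]
  rw [Finset.sum_comm]
  conv_rhs => rw [Finset.sum_comm]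
  rw [Finset.sum_comm]
  exact Finset.sum_congr rfl fun t _ => Finset.sum_comm

end Descent

/-! ### Solving the coefficient equations for quadratic forms. -/

section QuadraticCondition

variable {k : Type*} [Field k] (f : k[X]) [Fact (Irreducible f)]

theorem root_add_sq_eq_zero_iff (hf : f.Monic) :
    AdjoinRoot.root f + AdjoinRoot.root f ^ 2 = 0 ↔ f = X ∨ f = X + 1 := by
  have hirr : Irreducible f := Fact.out
  have h1 : AdjoinRoot.root f + AdjoinRoot.root f ^ 2 = AdjoinRoot.mk f (X * (X + 1)) := by
    simp; ring
  have hX1 : Irreducible (X + 1 : k[X]) := by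
    have := irreducible_X_sub_C (-1 : k)
    simpa using this
  have hm1 : (X + 1 : k[X]).Monic := by
    simpa using monic_X_add_C (1 : k)
  rw [h1, AdjoinRoot.mk_eq_zero, hirr.prime.dvd_mul, hirr.dvd_irreducible_iff_associated irreducible_X,
    hirr.dvd_irreducible_iff_associated hX1]
  constructor
  · exact Or.imp (eq_of_monic_of_associated hf monic_X) (eq_of_monic_of_associated hf hm1)
  · rintro (h | h) <;> simp [h]

variable [CharP k 2]

/-- In characteristic two `τ² + τ = δ + z + z²` with `δ = ε + ε²`. -/
theorem coeff_hankelSeries_mul (n : ℕ) (a : ℕ → AdjoinRoot f) (j : ℕ) :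
    PowerSeries.coeff (j + 2) (hankelSeries n a * (rootAddX f ^ 2 + rootAddX f)) =
      (AdjoinRoot.root f + AdjoinRoot.root f ^ 2) * PowerSeries.coeff (j + 2) (hankelSeries n a) +
      PowerSeries.coeff (j + 1) (hankelSeries n a) + PowerSeries.coeff j (hankelSeries n a) ∧
    PowerSeries.coeff 1 (hankelSeries n a * (rootAddX f ^ 2 + rootAddX f)) =
      (AdjoinRoot.root f + AdjoinRoot.root f ^ 2) * PowerSeries.coeff 1 (hankelSeries n a) + 1 ∧
    PowerSeries.coeff 0 (hankelSeries n a * (rootAddX f ^ 2 + rootAddX f)) =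
      (AdjoinRoot.root f + AdjoinRoot.root f ^ 2) := by
  have : CharP (AdjoinRoot f) 2 := charP_of_injective_algebraMap (algebraMap k (AdjoinRoot f)).injective 2
  have : CharP (PowerSeries (AdjoinRoot f)) 2 :=
    charP_of_injective_ringHom (PowerSeries.C_injective (R := AdjoinRoot f)) 2
  set b := hankelSeries n a with hb
  have hb0 : PowerSeries.coeff 0 b = 1 := by simp [hb, hankelSeries]
  have e : b * (rootAddX f ^ 2 + rootAddX f) =
      PowerSeries.C (AdjoinRoot.root f + AdjoinRoot.root f ^ 2) * b + PowerSeries.X * b +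
      PowerSeries.X ^ 2 * b := by
    rw [rootAddX, CharTwo.add_sq, map_add, map_pow]
    ring
  rw [e]
  refine ⟨?_, ?_, ?_⟩
  · rw [map_add, map_add, PowerSeries.coeff_C_mul, PowerSeries.coeff_succ_X_mul,
      PowerSeries.coeff_X_pow_mul]
  · rw [map_add, map_add, PowerSeries.coeff_C_mul, PowerSeries.coeff_succ_X_mul,
      PowerSeries.coeff_X_pow_mul', if_neg (by omega), add_zero, hb0]
  · rw [map_add, map_add, PowerSeries.coeff_C_mul, PowerSeries.coeff_zero_X_mul,
      PowerSeries.coeff_X_pow_mul', if_neg (by omega), add_zero, add_zero, hb0, mul_one]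

/-- For even `n` the odd-degree equations are `δ a_2 = 1` and `δ a_(i+2) = a_i`, so `δ ≠ 0` and `a_i
= δ^(-i/2)`. For odd `n` the even-degree equations are `δ = 0`, `a_2 = 1` and `a_i = 0` for the
later `i`. -/
theorem forall_coeff_eq_zero_iff_quadraticCase (hf : f.Monic) (n : ℕ) (hn : 1 ≤ n)
    (a : ℕ → AdjoinRoot f) :
    (∀ j ≤ n - 1, Even (n - 1 - j) →
      PowerSeries.coeff j (hankelSeries n a * (rootAddX f ^ 2 + rootAddX f)) = 0) ↔
      QuadraticCase f n (hankelOf n a) := by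
  have : CharP (AdjoinRoot f) 2 := charP_of_injective_algebraMap (algebraMap k (AdjoinRoot f)).injective 2
  have h2 := fun j => (coeff_hankelSeries_mul f n a j).1
  obtain ⟨-, h1, h0⟩ := coeff_hankelSeries_mul f n a 0
  have hb : ∀ j, PowerSeries.coeff j (hankelSeries n a) =
    if j = 0 then 1 else if Odd j ∧ j < n then a (j + 1) else 0 := fun j => by
      rw [hankelSeries, PowerSeries.coeff_mk]
  rw [QuadraticCase, ← root_add_sq_eq_zero_iff f hf]
  set δ := AdjoinRoot.root f + AdjoinRoot.root f ^ 2
  rcases Nat.even_or_odd n with he | ho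
  · have hno : ¬ Odd n := Nat.not_odd_iff_even.2 he
    simp only [hno, false_and, false_or, he, true_and]
    have hn2 : 2 ≤ n := by obtain ⟨i, rfl⟩ := he; omega
    rw [hankelOf_eq_iff_forall]
    constructor
    · intro h
      have e1 := h 1 (by omega) (by rw [show n - 1 - 1 = n - 2 by omega]; exact he.tsub even_two)
      rw [h1, hb, if_neg one_ne_zero, if_pos ⟨odd_one, by omega⟩, CharTwo.add_eq_zero] at e1
      have hδ : δ ≠ 0 := by
        rintro h0
        rw [h0, zero_mul] at e1
        exact zero_ne_one e1
      refine ⟨hδ, ?_⟩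
      rintro j ⟨i, rfl⟩ hj
      rw [show (2 * i + 1 + 1) / 2 = i + 1 by omega]
      induction i with
      | zero =>
        rw [zero_add, pow_one]
        exact eq_inv_of_mul_eq_one_right e1
      | succ i ih =>
        have e2 := h (2 * (i + 1) + 1) (by omega) (by
          obtain ⟨r, rfl⟩ := he
          exact ⟨r - i - 2, by omega⟩)
        rw [show 2 * (i + 1) + 1 = (2 * i + 1) + 2 by ring, h2, hb, hb, hb, if_neg (by omega),
          if_pos ⟨⟨i + 1, by ring⟩, by omega⟩, if_neg (by omega), if_neg (by
            rintro ⟨⟨r, hr⟩, -⟩; omega), if_neg (by omega), if_pos ⟨⟨i, by ring⟩, by omega⟩,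
          add_zero, CharTwo.add_eq_zero, ih (by omega)] at e2
        rw [show 2 * (i + 1) + 1 + 1 = 2 * i + 1 + 2 + 1 by ring, pow_succ, mul_inv, ← e2]
        field_simp
    · rintro ⟨hδ, h⟩ j hj hje
      rcases j with _ | _ | j
      · exfalso
        obtain ⟨r, hr⟩ := he
        obtain ⟨s, hs⟩ := hje
        omega
      · rw [h1, hb, if_neg one_ne_zero, if_pos ⟨odd_one, by omega⟩, h 1 odd_one (by omega)]
        simp only [Nat.reduceAdd, Nat.reduceDiv, pow_one]
        rw [mul_inv_cancel₀ hδ, CharTwo.add_self_eq_zero]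
      · obtain ⟨i, rfl⟩ : Odd j := by
          obtain ⟨r, hr⟩ := he
          obtain ⟨s, hs⟩ := hje
          exact ⟨r - s - 2, by omega⟩
        rw [h2, hb, hb, hb, if_neg (by omega),
          if_pos ⟨⟨i + 1, by ring⟩, by omega⟩, if_neg (by omega), if_neg (by
            rintro ⟨⟨r, hr⟩, -⟩; omega), if_neg (by omega), if_pos ⟨⟨i, by ring⟩, by omega⟩,
          add_zero, h _ ⟨i + 1, by ring⟩ (by omega), h _ ⟨i, rfl⟩ (by omega),
          show (2 * i + 1 + 2 + 1) / 2 = i + 1 + 1 by omega, show (2 * i + 1 + 1) / 2 = i + 1 by omega,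
          CharTwo.add_eq_zero, pow_succ _ (i + 1), mul_inv]
        field_simp
  · have hne : ¬ Even n := Nat.not_even_iff_odd.2 ho
    simp only [hne, false_and, or_false, ho, true_and]
    -- When `n = 1` the sum over even `i` is empty, so the same sequence `a` describes both odd
    -- cases.
    have hA : (if n = 1 then 1 else hankelUnit n (n + 1) 1 + hankelUnit n (n + 2) 1) =
        hankelOf n fun i => if i = 2 then (1 : AdjoinRoot f) else 0 := by
      split_ifs with h
      · subst h
        ext p q
        obtain rfl := Subsingleton.elim p q
        rw [Matrix.one_apply_eq]
        simp [hankelOf, hankelUnit]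
      · rw [hankelOf, Finset.sum_eq_single 2]
        · simp
        · intro i _ hi
          ext p q
          simp [hankelUnit, hi]
        · intro h'
          exfalso
          apply h'
          obtain ⟨r, rfl⟩ := ho
          rw [Finset.mem_filter, Finset.mem_Icc]
          exact ⟨by omega, even_two⟩
    rw [hA, hankelOf_eq_iff_forall]
    have hpar : ∀ i, 2 * i + 2 ≤ n - 1 → Even (n - 1 - (2 * i + 2)) := by
      intro i hi
      obtain ⟨r, rfl⟩ := ho
      exact ⟨r - i - 1, by omega⟩
    have hstep : ∀ i, 2 * i + 2 ≤ n - 1 →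
        PowerSeries.coeff (2 * i + 2) (hankelSeries n a * (rootAddX f ^ 2 + rootAddX f)) =
        a (2 * i + 1 + 1) + if 2 * i + 1 + 1 = 2 then 1 else 0 := by
      intro i hi
      rw [h2, hb, hb, hb, if_neg (by omega), if_neg (by rintro ⟨⟨r, hr⟩, -⟩; omega),
        if_neg (by omega), if_pos ⟨⟨i, rfl⟩, by omega⟩, mul_zero, zero_add]
      congr 1
      have : ¬ (Odd (2 * i) ∧ 2 * i < n) := by rintro ⟨⟨r, hr⟩, -⟩; omega
      rw [if_neg this]
      exact if_congr (by omega) rfl rfl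
    constructor
    · intro h
      refine ⟨?_, ?_⟩
      · rw [← h0]
        refine h 0 (by omega) ?_
        obtain ⟨r, rfl⟩ := ho
        exact ⟨r, by omega⟩
      · rintro j ⟨i, rfl⟩ hj
        have hi : 2 * i + 2 ≤ n - 1 := by obtain ⟨r, rfl⟩ := ho; omega
        have := h (2 * i + 2) hi (hpar i hi)
        rwa [hstep i hi, CharTwo.add_eq_zero] at this
    · rintro ⟨hδ, h⟩ j hj hje
      obtain ⟨i, hi⟩ : Even j := by
        obtain ⟨r, rfl⟩ := ho
        obtain ⟨s, hs⟩ := hje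
        exact ⟨r - s, by omega⟩
      rcases i with _ | i
      · rw [hi, h0, hδ]
      · obtain rfl : j = 2 * i + 2 := by omega
        rw [hstep i hj, CharTwo.add_eq_zero]
        exact h _ ⟨i, rfl⟩ (by omega)

end QuadraticCondition

/-! ### Isometry classes of symplectic forms and existence of quadratic forms. -/

section Classification

variable {k : Type*} [Field k] [PerfectField k] (f : k[X]) [Fact (Irreducible f)]

/-- The Gram matrix attached to an element of `K[z] / (z ^ n)`. -/
abbrev seriesGram (hf : f.Monic) (n : ℕ) (hn : 1 ≤ n)
    (c : TruncatedSeries (AdjoinRoot f) n) : Matrix (Idx f n) (Idx f n) k :=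
  gram (powersEquiv f hf n) (traceTop k (AdjoinRoot f) hn) c

theorem traceTop_nondegenerate (n : ℕ) (hn : 1 ≤ n) (a : TruncatedSeries (AdjoinRoot f) n)
    (h : ∀ b, traceTop k (AdjoinRoot f) hn (a * b) = 0) : a = 0 := by
  have hf0 : f ≠ 0 := (Fact.out : Irreducible f).ne_zero
  have : FiniteDimensional k (AdjoinRoot f) := (AdjoinRoot.powerBasis hf0).finite
  exact eq_zero_of_forall_traceTop_mul hn a h

theorem coeff_zero_ne_zero_of_evenPart {K : Type*} [Field K] [CharP K 2] {b : PowerSeries K}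
    (hb : evenPart b = 1) : PowerSeries.coeff 0 b ≠ 0 := by
  have h := congrArg (PowerSeries.coeff 0) hb
  rw [coeff_evenPart, if_pos Even.zero] at h
  rw [h]
  simp

variable [CharP k 2]

theorem not_isOrthogonallyDecomposable (hf : f.Monic) (n : ℕ) (hn : 1 ≤ n)
    (B : LinearMap.BilinForm k (CSpace f n)) :
    ¬ IsOrthogonallyDecomposable (CRep f n) B := by
  refine not_isOrthogonallyDecomposable_CRep f n (fun X hX hXX => ?_) B
  obtain ⟨w, hw⟩ := exists_eq_mul_of_commute (powersEquiv_companionPow_mulVec f hf n)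
    (adjoin_truncRoot f hf n) hX
  have hww : w * w = w := by
    have h1 := congrArg (fun Y => powersEquiv f hf n (Y.mulVec ((powersEquiv f hf n).symm 1))) hXX
    simp only [← Matrix.mulVec_mulVec, hw, LinearEquiv.apply_symm_apply, mul_one] at h1
    exact h1
  rcases eq_zero_or_eq_one_of_mul_self hn hww with rfl | rfl
  · left
    refine matrix_ext_of_equiv (powersEquiv f hf n) fun x => ?_
    rw [hw, Matrix.zero_mulVec, map_zero, zero_mul]
  · right
    refine matrix_ext_of_equiv (powersEquiv f hf n) fun x => ?_
    rw [hw, Matrix.one_mulVec, one_mul]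

theorem offDiagonalForm_seriesGram_mem (hf : f.Monic) (n : ℕ) (hn : 1 ≤ n)
    {c : TruncatedSeries (AdjoinRoot f) n} (hc : IsUnit c) :
    offDiagonalForm (seriesGram f hf n hn c) ∈ IndecomposableSymplecticForms (CRep f n) := by
  refine ⟨?_, ?_, not_isOrthogonallyDecomposable f hf n hn _⟩
  · rw [offDiagonalForm, isSymplectic_toBilin'_fromBlocks_iff]
    exact ⟨gram_transpose _ _ _, (isUnit_gram_iff (traceTop_nondegenerate f n hn) c).2 hc, by simp,
      by simp⟩
  · rw [offDiagonalForm, isInvariantForm_CRep_iff]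
    exact ⟨rfl, rfl, transpose_mul_gram (powersEquiv_companionPow_mulVec f hf n) c⟩

theorem exists_isometricForms_hankelSeries (hf : f.Monic) (n : ℕ) (hn : 1 ≤ n)
    {B : LinearMap.BilinForm k (CSpace f n)}
    (hB : B ∈ IndecomposableSymplecticForms (CRep f n)) :
    ∃ a, IsometricForms (CRep f n)
      (offDiagonalForm (seriesGram f hf n hn (truncMk n (hankelSeries n a)))) B := by
  have : CharP (AdjoinRoot f) 2 :=
    charP_of_injective_algebraMap (algebraMap k (AdjoinRoot f)).injective 2
  have hf0 : f ≠ 0 := (Fact.out : Irreducible f).ne_zero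
  have : FiniteDimensional k (AdjoinRoot f) := (AdjoinRoot.powerBasis hf0).finite
  have : PerfectField (AdjoinRoot f) := Algebra.IsAlgebraic.perfectField k
  obtain ⟨hs, hi, -⟩ := hB
  rw [← Matrix.toBilin'_toMatrix' B] at hs hi ⊢
  generalize LinearMap.BilinForm.toMatrix' B = M at hs hi ⊢
  rw [← Matrix.fromBlocks_toBlocks M] at hs hi ⊢
  generalize M.toBlocks₁₁ = P at hs hi ⊢
  generalize M.toBlocks₁₂ = Q at hs hi ⊢
  generalize M.toBlocks₂₁ = Q' at hs hi ⊢
  generalize M.toBlocks₂₂ = Z at hs hi ⊢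
  obtain ⟨rfl, rfl, hQ⟩ := (isInvariantForm_CRep_iff f n P Q Q' Z).1 hi
  obtain ⟨hQs, hQu, hZ, hZ0⟩ := (isSymplectic_toBilin'_fromBlocks_iff _ Z).1 hs
  obtain ⟨c, rfl⟩ := exists_eq_gram (traceTop_nondegenerate f n hn)
    (powersEquiv_companionPow_mulVec f hf n) (adjoin_truncRoot f hf n) hQ
  rw [isUnit_gram_iff (traceTop_nondegenerate f n hn)] at hQu
  obtain ⟨g, rfl⟩ := truncMk_surjective n c
  obtain ⟨u, hu, hgu⟩ := exists_mul_sq_evenPart_eq_one ((isUnit_truncMk_iff hn).1 hQu)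
  obtain ⟨a, ha⟩ := exists_hankelSeries_eq n hgu
  refine ⟨a, ?_⟩
  rw [isometricForms_offDiagonalForm_iff f n _ _ _ (gram_transpose _ _ _)
    ((isUnit_gram_iff (traceTop_nondegenerate f n hn) _).2 hQu) hZ hZ0]
  obtain ⟨v, rfl⟩ := hu
  -- The normal form represents `g v²`, so multiplication by `v⁻¹` carries it back to `g`.
  refine ⟨mulMatrix (powersEquiv f hf n) (truncMk n v.inv),
    isUnit_mulMatrix _ ((v⁻¹).isUnit.map _),
    mulMatrix_commute (powersEquiv_companionPow_mulVec f hf n) _, ?_⟩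
  rw [ha, transpose_mul_gram_mul _ _ _ (mulMatrix_mulVec _ _) (mulMatrix_mulVec _ _), ← map_mul,
    ← map_mul]
  have e : g * v.val ^ 2 * (v.inv * v.inv) = g := by
    rw [mul_assoc, ← pow_two, ← mul_pow, v.val_inv, one_pow, mul_one]
  rw [e]

theorem truncMk_eq_of_isometricForms (hf : f.Monic) (n : ℕ) (hn : 1 ≤ n)
    {b b' : PowerSeries (AdjoinRoot f)}
    [CharP (AdjoinRoot f) 2] (hb : evenPart b = 1) (hb' : evenPart b' = 1)
    (h : IsometricForms (CRep f n) (offDiagonalForm (seriesGram f hf n hn (truncMk n b)))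
      (offDiagonalForm (seriesGram f hf n hn (truncMk n b')))) :
    truncMk n b = truncMk n b' := by
  rw [isometricForms_offDiagonalForm_iff' f n _ _ (gram_transpose _ _ _)
    ((isUnit_gram_iff (traceTop_nondegenerate f n hn) _).2
      ((isUnit_truncMk_iff hn).2 (coeff_zero_ne_zero_of_evenPart hb')))] at h
  obtain ⟨X, -, hX, hXb⟩ := h
  obtain ⟨w, hw⟩ := exists_eq_mul_of_commute (powersEquiv_companionPow_mulVec f hf n)
    (adjoin_truncRoot f hf n) hX
  rw [transpose_mul_gram_mul _ _ _ hw hw] at hXb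
  have := gram_injective (traceTop_nondegenerate f n hn) hXb
  obtain ⟨u, rfl⟩ := truncMk_surjective n w
  rw [← map_mul, ← map_mul, ← pow_two] at this
  exact truncMk_eq_of_evenPart_eq_one hb hb' this

/-- For `y` corresponding to `u`, the two sides are `λ(b τ² u²)` and `λ(b τ u²)`; their sum vanishes
for all `u` exactly when `b(τ² + τ)` is orthogonal to all squares. -/
theorem forall_mulVec_seriesGram_iff (hf : f.Monic) (n : ℕ) (hn : 1 ≤ n)
    (a : ℕ → AdjoinRoot f) :
    (∀ y, (companionPow f n).mulVec y ⬝ᵥ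
        (seriesGram f hf n hn (truncMk n (hankelSeries n a))).mulVec ((companionPow f n).mulVec y) =
      (companionPow f n).mulVec y ⬝ᵥ
        (seriesGram f hf n hn (truncMk n (hankelSeries n a))).mulVec y) ↔
      QuadraticCase f n (hankelOf n a) := by
  have : CharP (AdjoinRoot f) 2 :=
    charP_of_injective_algebraMap (algebraMap k (AdjoinRoot f)).injective 2
  have hf0 : f ≠ 0 := (Fact.out : Irreducible f).ne_zero
  have : FiniteDimensional k (AdjoinRoot f) := (AdjoinRoot.powerBasis hf0).finite
  have : PerfectField (AdjoinRoot f) := Algebra.IsAlgebraic.perfectField k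
  rw [← forall_coeff_eq_zero_iff_quadraticCase f hf n hn a,
    ← forall_trace_coeff_mul_sq_iff (Algebra.trace k (AdjoinRoot f))
      (fun a h => eq_zero_of_forall_trace_mul h)]
  have key : ∀ u : PowerSeries (AdjoinRoot f), ∀ y, powersEquiv f hf n y = truncMk n u →
      ((companionPow f n).mulVec y ⬝ᵥ
        (seriesGram f hf n hn (truncMk n (hankelSeries n a))).mulVec ((companionPow f n).mulVec y) =
      (companionPow f n).mulVec y ⬝ᵥ
        (seriesGram f hf n hn (truncMk n (hankelSeries n a))).mulVec y ↔
      Algebra.trace k (AdjoinRoot f) (PowerSeries.coeff (n - 1)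
        (hankelSeries n a * (rootAddX f ^ 2 + rootAddX f) * u ^ 2)) = 0) := by
    intro u y hy
    rw [dotProduct_gram_mulVec, dotProduct_gram_mulVec, powersEquiv_companionPow_mulVec, hy,
      truncRoot, ← CharTwo.add_eq_zero, ← map_add, ← map_mul, ← map_mul, ← map_mul, ← map_mul,
      ← map_mul, ← map_add, traceTop_truncMk]
    rw [show hankelSeries n a * (rootAddX f * u * (rootAddX f * u)) +
      hankelSeries n a * (rootAddX f * u * u) =
      hankelSeries n a * (rootAddX f ^ 2 + rootAddX f) * u ^ 2 by ring]
  constructor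
  · intro h u
    rw [← key u ((powersEquiv f hf n).symm (truncMk n u)) (LinearEquiv.apply_symm_apply _ _)]
    exact h _
  · intro h y
    obtain ⟨u, hu⟩ := truncMk_surjective n (powersEquiv f hf n y)
    rw [key u y hu.symm]
    exact h u

/-- If `W⁻¹` had zero diagonal, it would be alternating and so would `W`, making `b` orthogonal to
all squares. But the constant coefficient `1` for odd `n`, or `a_2 = δ⁻¹` for even `n`, prevents
this. -/
theorem exists_seriesGram_inv_diag_ne_zero (hf : f.Monic) (n : ℕ) (hn : 1 ≤ n)
    (a : ℕ → AdjoinRoot f)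
    (h : QuadraticCase f n (hankelOf n a)) :
    ∃ t, (seriesGram f hf n hn (truncMk n (hankelSeries n a)))⁻¹ t t ≠ 0 := by
  have : CharP (AdjoinRoot f) 2 :=
    charP_of_injective_algebraMap (algebraMap k (AdjoinRoot f)).injective 2
  have hf0 : f ≠ 0 := (Fact.out : Irreducible f).ne_zero
  have : FiniteDimensional k (AdjoinRoot f) := (AdjoinRoot.powerBasis hf0).finite
  have : PerfectField (AdjoinRoot f) := Algebra.IsAlgebraic.perfectField k
  set b := hankelSeries n a with hb
  set W := seriesGram f hf n hn (truncMk n b) with hW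
  have hWs : W.transpose = W := gram_transpose _ _ _
  have hWu : IsUnit W := (isUnit_gram_iff (traceTop_nondegenerate f n hn) _).2
      ((isUnit_truncMk_iff hn).2 (coeff_zero_ne_zero_of_evenPart (evenPart_hankelSeries n a)))
  have hWd := (Matrix.isUnit_iff_isUnit_det _).1 hWu
  by_contra! h0
  have hPs : W⁻¹.transpose = W⁻¹ := by rw [Matrix.transpose_nonsing_inv, hWs]
  have hy : ∀ y, y ⬝ᵥ W.mulVec y = 0 := by
    intro y
    have := dotProduct_mulVec_self hPs (W.mulVec y)
    rw [Matrix.mulVec_mulVec, Matrix.nonsing_inv_mul _ hWd, Matrix.one_mulVec, dotProduct_comm] at this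
    rw [this]
    exact Finset.sum_eq_zero fun i _ => by rw [h0, zero_mul]
  have hc := (forall_trace_coeff_mul_sq_iff (Algebra.trace k (AdjoinRoot f))
      (fun a h => eq_zero_of_forall_trace_mul h) n b).1 fun u => by
    have := hy ((powersEquiv f hf n).symm (truncMk n u))
    rwa [dotProduct_gram_mulVec, LinearEquiv.apply_symm_apply, ← map_mul, ← map_mul,
      traceTop_truncMk, ← pow_two] at this
  rcases h with ⟨ho, -, -⟩ | ⟨he, hX, hA⟩
  · have := hc 0 (by omega) (by obtain ⟨r, rfl⟩ := ho; exact ⟨r, by omega⟩)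
    exact coeff_zero_ne_zero_of_evenPart (evenPart_hankelSeries n a) this
  · have hn2 : 2 ≤ n := by obtain ⟨r, rfl⟩ := he; omega
    have := hc 1 (by omega) (by obtain ⟨r, rfl⟩ := he; exact ⟨r - 1, by omega⟩)
    rw [hankelOf_eq_iff_forall] at hA
    rw [hb, hankelSeries, PowerSeries.coeff_mk, if_neg one_ne_zero, if_pos ⟨odd_one, by omega⟩,
      hA 1 odd_one (by omega), inv_eq_zero] at this
    rw [← root_add_sq_eq_zero_iff f hf] at hX
    exact hX (by simpa using this)

end Classification

/-! ### Representatives for the isometry classes of quadratic forms. -/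

section Representatives

variable {k : Type*} [Field k]

theorem IsCosetReps.eq_of_sub_eq {P : Set k} (hP : IsCosetReps P) {x y r : k} (hx : x ∈ P)
    (hy : y ∈ P) (h : x - y = r ^ 2 + r) : x = y :=
  (hP.2 y trivial).unique ⟨hx, r, h⟩ ⟨hy, 0, by simp⟩

theorem isFullSetOfReps_upperQuadraticForm [CharP k 2] [PerfectField k] (f : k[X]) (n : ℕ)
    {W : Matrix (Idx f n) (Idx f n) k} (hW : W.transpose = W) (hWu : IsUnit W)
    (hC : InvariantQuadraticForms (CRep f n) (offDiagonalForm W) =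
      Set.range (upperQuadraticForm W)) {t : Idx f n} (ht : W⁻¹ t t ≠ 0) {P : Set k}
    (hP : IsCosetReps P) :
    IsFullSetOfReps (IsometricQuadraticForms (CRep f n))
      (InvariantQuadraticForms (CRep f n) (offDiagonalForm W))
      ((fun x => upperQuadraticForm W (Pi.single t ((W⁻¹ t t)⁻¹ * x))) '' P) ∧
    Set.InjOn (fun x => upperQuadraticForm W (Pi.single t ((W⁻¹ t t)⁻¹ * x))) P := by
  -- The scaling by the inverse of the diagonal entry makes the invariant of the representative
  -- exactly `x`.
  have hsum : ∀ x, ∑ i, W⁻¹ i i * (Pi.single t ((W⁻¹ t t)⁻¹ * x) : Idx f n → k) i = x := by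
    intro x
    rw [Finset.sum_eq_single t]
    · rw [Pi.single_eq_same, mul_inv_cancel_left₀ ht]
    · intro i _ hi
      rw [Pi.single_eq_of_ne hi, mul_zero]
    · simp
  rw [hC]
  refine ⟨⟨?_, ?_⟩, ?_⟩
  · rintro _ ⟨x, -, rfl⟩
    exact ⟨_, rfl⟩
  · rintro _ ⟨d, rfl⟩
    obtain ⟨x, ⟨hx, r, hr⟩, -⟩ := hP.2 (∑ i, W⁻¹ i i * d i) trivial
    refine ⟨_, ⟨⟨x, hx, rfl⟩, isometric_of_sq_add_self f n hW hWu ht (r := r) ?_⟩, ?_⟩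
    · rw [hsum, hr]
    · rintro _ ⟨⟨y, hy, rfl⟩, hiso⟩
      obtain ⟨s, hs⟩ := exists_sq_add_self_of_isometric f n hW hWu hiso
      rw [hsum] at hs
      have : y = x := hP.eq_of_sub_eq (r := s + r) hy hx (by
        rw [CharTwo.add_sq]
        linear_combination hs - hr - CharTwo.add_self_eq_zero (r ^ 2 + r))
      rw [this]
  · intro x hx y hy hxy
    have hiso : IsometricQuadraticForms (CRep f n)
        (upperQuadraticForm W (Pi.single t ((W⁻¹ t t)⁻¹ * x)))
        (upperQuadraticForm W (Pi.single t ((W⁻¹ t t)⁻¹ * y))) := by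
      refine ⟨LinearEquiv.refl k _, fun _ _ => rfl, fun v => ?_⟩
      exact congrArg (fun q : QuadraticForm k _ => q v) hxy
    obtain ⟨s, hs⟩ := exists_sq_add_self_of_isometric f n hW hWu hiso
    rw [hsum, hsum] at hs
    exact hP.eq_of_sub_eq hx hy hs

end Representatives

end

/-! ### Assembly of the classification. -/

theorem theorem3 {k : Type*} [Field k] [CharP k 2] [PerfectField k]
    (f : k[X]) [Fact (Irreducible f)] (hmonic : f.Monic) (n : ℕ) (hn : 1 ≤ n)
    {E : Type*} [Field E] [Algebra k E]
    (e : Fin f.natDegree → E) (hinj : Function.Injective e) (he : ∀ t, aeval (e t) f = 0) :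
    -- the matrices `𝒱(X)` have their entries in `k`
    ∃ W : Matrix (Fin n) (Fin n) (AdjoinRoot f) → Matrix (Idx f n) (Idx f n) k,
      (∀ A, (W A).map (algebraMap k E) = scriptV f n e he A) ∧
      -- symplectic forms
      (∀ B : LinearMap.BilinForm k (CSpace f n), IsSymplectic B → IsInvariantForm (CRep f n) B →
        ¬ IsOrthogonallyDecomposable (CRep f n) B) ∧
      IsFullSetOfReps (IsometricForms (CRep f n)) (IndecomposableSymplecticForms (CRep f n))
        ((fun A => offDiagonalForm (W A)) '' hankelSet (AdjoinRoot f) n) ∧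
      Set.InjOn (fun A => offDiagonalForm (W A)) (hankelSet (AdjoinRoot f) n) ∧
      (Finite k → ∀ R : Set (LinearMap.BilinForm k (CSpace f n)),
        IsFullSetOfReps (IsometricForms (CRep f n)) (IndecomposableSymplecticForms (CRep f n)) R →
        R.ncard = Nat.card k ^ (f.natDegree * (n / 2))) ∧
      -- quadratic forms
      (∀ A ∈ hankelSet (AdjoinRoot f) n,
        ((InvariantQuadraticForms (CRep f n) (offDiagonalForm (W A))).Nonempty ↔
          QuadraticCase f n A) ∧
        (QuadraticCase f n A →
          InvariantQuadraticForms (CRep f n) (offDiagonalForm (W A)) =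
            Set.range (upperQuadraticForm (W A)) ∧
          (∃ t, (W A)⁻¹ t t ≠ 0) ∧
          ∀ t, (W A)⁻¹ t t ≠ 0 → ∀ P : Set k, IsCosetReps P →
            IsFullSetOfReps (IsometricQuadraticForms (CRep f n))
              (InvariantQuadraticForms (CRep f n) (offDiagonalForm (W A)))
              ((fun x => upperQuadraticForm (W A) (Pi.single t (((W A)⁻¹ t t)⁻¹ * x))) '' P) ∧
            Set.InjOn
              (fun x => upperQuadraticForm (W A) (Pi.single t (((W A)⁻¹ t t)⁻¹ * x))) P)) := by
  have : CharP (AdjoinRoot f) 2 :=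
    charP_of_injective_algebraMap (algebraMap k (AdjoinRoot f)).injective 2
  have hunit : ∀ a : ℕ → AdjoinRoot f, IsUnit (truncMk n (hankelSeries n a)) := fun a =>
    (isUnit_truncMk_iff hn).2 (coeff_zero_ne_zero_of_evenPart (evenPart_hankelSeries n a))
  have hfull : IsFullSetOfReps (IsometricForms (CRep f n))
      (IndecomposableSymplecticForms (CRep f n))
      ((fun A => offDiagonalForm (traceMatrix f n A)) '' hankelSet (AdjoinRoot f) n) := by
    constructor
    · rintro _ ⟨_, ⟨a, rfl⟩, rfl⟩
      simp only [traceMatrix_hankelOf f hmonic n hn]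
      exact offDiagonalForm_seriesGram_mem f hmonic n hn (hunit a)
    · intro B hB
      obtain ⟨a, ha⟩ := exists_isometricForms_hankelSeries f hmonic n hn hB
      refine ⟨offDiagonalForm (traceMatrix f n (hankelOf n a)), ⟨⟨_, ⟨a, rfl⟩, rfl⟩, ?_⟩, ?_⟩
      · rwa [traceMatrix_hankelOf f hmonic n hn]
      · rintro _ ⟨⟨_, ⟨a', rfl⟩, rfl⟩, ha'⟩
        simp only [traceMatrix_hankelOf f hmonic n hn] at ha' ⊢
        rw [truncMk_eq_of_isometricForms f hmonic n hn (evenPart_hankelSeries n a')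
          (evenPart_hankelSeries n a) (ha'.trans ha.symm)]
  have hinjOn : Set.InjOn (fun A => offDiagonalForm (traceMatrix f n A))
      (hankelSet (AdjoinRoot f) n) := by
    rintro _ ⟨a, rfl⟩ _ ⟨a', rfl⟩ h
    simp only [traceMatrix_hankelOf f hmonic n hn] at h
    rw [hankelOf_eq_iff]
    refine truncMk_eq_of_isometricForms f hmonic n hn (evenPart_hankelSeries n a)
      (evenPart_hankelSeries n a') ?_
    rw [h]
    exact isometricForms_refl _ _
  refine ⟨traceMatrix f n, traceMatrix_map f n e hinj he,
    fun B _ _ => not_isOrthogonallyDecomposable f hmonic n hn B, hfull, hinjOn, ?_, ?_⟩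
  · intro hfin R hR
    have hf0 : f ≠ 0 := (Fact.out : Irreducible f).ne_zero
    have : FiniteDimensional k (AdjoinRoot f) := (AdjoinRoot.powerBasis hf0).finite
    rw [IsFullSetOfReps.ncard_eq (fun _ _ h => h.symm) (fun _ _ _ h h' => h.trans h')
      (isometricForms_refl _) hR hfull, hinjOn.ncard_image, natCard_hankelSet,
      Module.natCard_eq_pow_finrank (K := k), (AdjoinRoot.powerBasis hf0).finrank,
      AdjoinRoot.powerBasis_dim, pow_mul]
  · rintro _ ⟨a, rfl⟩
    rw [traceMatrix_hankelOf f hmonic n hn]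
    set W := gram (powersEquiv f hmonic n) (traceTop k (AdjoinRoot f) hn)
      (truncMk n (hankelSeries n a)) with hW
    have hWs : W.transpose = W := gram_transpose _ _ _
    have hWu : IsUnit W := (isUnit_gram_iff (traceTop_nondegenerate f n hn) _).2 (hunit a)
    have hmem := mem_invariantQuadraticForms_iff f n hWs
    have hcase := forall_mulVec_seriesGram_iff f hmonic n hn a
    have hC : QuadraticCase f n (hankelOf n a) →
        InvariantQuadraticForms (CRep f n) (offDiagonalForm W) =
          Set.range (upperQuadraticForm W) := by
      intro h
      ext q
      rw [hmem, and_iff_right (hcase.2 h), Set.mem_range]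
    refine ⟨⟨?_, fun h => ?_⟩, fun h => ⟨hC h, exists_seriesGram_inv_diag_ne_zero f hmonic n hn a h,
      fun t ht P hP => isFullSetOfReps_upperQuadraticForm f n hWs hWu (hC h) ht hP⟩⟩
    · rintro ⟨q, hq⟩
      exact hcase.1 ((hmem q).1 hq).1
    · rw [hC h]
      exact Set.range_nonempty _
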